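/- **Setting.** Let $\lambda,\mu,\tau\in\mathbb C$ and an integer $p\ge 1$ satisfy $|\lambda|\ge|\mu|>1$ and $(\lambda-\mu^p)\tau=0$. Let $\varphi\in\mathrm{Diff}^\infty([0,\infty))$ satisfy $\varphi(x)>x$ for $x>0$, and let $\varphi$ be tangent to the identity to infinite order at $0$. Put $\tilde R=(\mathbb C^2\times[0,\infty))\setminus\{(O,0)\}$, foliated by $\mathbb C^2\times\{x\}$ $(x>0)$ and $(\mathbb C^2\setminus\{O\})\times\{0\}$, and $$T(z_1,z_2,x)=(\lambda z_1+\tau z_2^{p},\ \mu z_2,\ \varphi(x)).$$ Let $R=\tilde R/T^{\mathbb Z}$, with the induced smooth structure, foliation and complex structures on the leaves, and let $H$ be its boundary leaf (the image of $x=0$). Let $\mathrm{Aut}(R)$ be the group of diffeomorphisms of $R$ that preserve the foliation and are biholomorphic between leaves, and let $\mathrm{Aut}(R,H)$ be the subgroup of those which are the identity on $H$. Let $Z_\varphi$ be the centralizer of $\varphi$ in $\mathrm{Diff}^\infty([0,\infty))$. Let $\mathcal S_{\varphi,\lambda}$ be the complex vector space of pairs $(\beta_1,\beta_2)$ of smooth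 functions $(0,\infty)\to\mathbb C$ with $$\beta_1\circ\varphi=\lambda\beta_1+\beta_2,\qquad \beta_2\circ\varphi=\lambda\beta_2 .$$ **Theorem 3.12.** Assume $\tau=1$ and $\lambda=\mu$. Then $\mathcal S_{\varphi,\lambda}$ is infinite dimensional, and each of its elements, extended by $0$ at $x=0$, is a pair of smooth functions on $[0,\infty)$. There are a short exact sequence of groups $$0\to\mathcal S_{\varphi,\lambda}\xrightarrow{\ i\ }\mathrm{Aut}(R,H)\xrightarrow{\ P\ }Z_\varphi\to 1$$ and an isomorphism $\mathcal S_{\varphi,\lambda}\rtimes Z_\varphi\cong\mathrm{Aut}(R,H)$ compatible with it. Here $Z_\varphi$ acts on $\mathcal S_{\varphi,\lambda}$ by precomposition, $(\beta_1,\beta_2)\mapsto(\beta_1\circ\eta,\beta_2\circ\eta)$; this is a right action, so the semidirect product has the group law $(\beta,\eta)(\beta',\eta')=(\beta+\beta'\circ\eta^{-1},\ \eta\circ\eta')$. For $x>0$, the isomorphism sends $\beta\in\mathcal S_{\varphi,\lambda}$ to the automorphism $i(\beta):[z_1,z_2,x]\mapsto[z_1+\beta_1(x),z_2+\beta_2(x),x]$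 and $\eta\in Z_\varphi$ to the automorphism $[z_1,z_2,x]\mapsto[z_1,z_2,\eta(x)]$. -/

import Mathlib

open scoped NNReal ContDiff

namespace LCReeb

/-! Diffeomorphisms of the half line `[0, ∞)`, which is modelled by `ℝ≥0`. -/

/-- A self-map of `[0, ∞)` is smooth up to the boundary point `0`. -/
def HalfLineSmooth (f : ℝ≥0 → ℝ≥0) : Prop :=
  ContDiffOn ℝ ∞ (fun t : ℝ => (f t.toNNReal : ℝ)) (Set.Ici 0)

theorem HalfLineSmooth.comp {f g : ℝ≥0 → ℝ≥0} (hf : HalfLineSmooth f) (hg : HalfLineSmooth g) :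
    HalfLineSmooth (f ∘ g) := by
  have h := ContDiffOn.comp (g := fun t : ℝ => (f t.toNNReal : ℝ)) hf hg
    (fun x _ => (g x.toNNReal).2)
  refine h.congr ?_
  intro x _
  simp

theorem HalfLineSmooth.id : HalfLineSmooth (fun x => x) := by
  refine contDiffOn_id.congr ?_
  intro x hx
  simpa using hx

theorem HalfLineSmooth.continuous {f : ℝ≥0 → ℝ≥0} (hf : HalfLineSmooth f) : Continuous f := by
  have h := hf.continuousOn
  have h2 : Continuous fun x : ℝ≥0 => (f (x : ℝ).toNNReal : ℝ) :=
    h.comp_continuous NNReal.continuous_coe (fun x => x.2)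
  simp only [Real.toNNReal_coe] at h2
  exact continuous_induced_rng.mpr h2

/-- The group `Diff^∞([0, ∞))`, with composition as multiplication. -/
def halfLineDiff : Subgroup (Equiv.Perm ℝ≥0) where
  carrier := {η | HalfLineSmooth η ∧ HalfLineSmooth η.symm}
  mul_mem' := fun ha hb => ⟨ha.1.comp hb.1, hb.2.comp ha.2⟩
  one_mem' := ⟨HalfLineSmooth.id, HalfLineSmooth.id⟩
  inv_mem' := fun ha => ⟨ha.2, ha.1⟩

theorem map_zero_of_mem (η : halfLineDiff) : η.1 0 = 0 := by
  have hc : Continuous η.1 := η.2.1.continuous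
  rcases hc.strictMono_of_inj η.1.injective with h | h
  · obtain ⟨y, hy⟩ := η.1.surjective 0
    have : η.1 0 ≤ η.1 y := h.monotone (zero_le : (0 : ℝ≥0) ≤ y)
    rw [hy] at this
    exact le_antisymm this zero_le
  · obtain ⟨y, hy⟩ := η.1.surjective (η.1 0 + 1)
    have h1 : η.1 y ≤ η.1 0 := h.antitone (zero_le : (0 : ℝ≥0) ≤ y)
    rw [hy] at h1
    exact absurd h1 (not_le.mpr (lt_add_of_pos_right _ one_pos))

theorem pos_iff (η : halfLineDiff) (x : ℝ≥0) : 0 < η.1 x ↔ 0 < x := by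
  rw [pos_iff_ne_zero, pos_iff_ne_zero, not_iff_not]
  constructor
  · intro h
    exact η.1.injective (h.trans (map_zero_of_mem η).symm)
  · rintro rfl
    exact map_zero_of_mem η

/-- The restriction of a diffeomorphism of `[0, ∞)` to `(0, ∞)`. -/
def onPos (η : halfLineDiff) (x : Set.Ioi (0 : ℝ)) : Set.Ioi (0 : ℝ) :=
  ⟨(η.1 ⟨x.1, le_of_lt x.2⟩ : ℝ), NNReal.coe_pos.mpr ((pos_iff η _).mpr x.2)⟩

theorem onPos_mul (η θ : halfLineDiff) (x : Set.Ioi (0 : ℝ)) :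
    onPos (η * θ) x = onPos η (onPos θ x) := rfl

theorem onPos_one (x : Set.Ioi (0 : ℝ)) : onPos 1 x = x := rfl

/-- `φ` is tangent to the identity to infinite order at `0`. -/
def InfinitelyTangentToId (φ : halfLineDiff) : Prop :=
  ∀ k : ℕ, iteratedDerivWithin k (fun t : ℝ => (φ.1 t.toNNReal : ℝ) - t) (Set.Ici 0) 0 = 0

/-- The centralizer `Z_φ` of `φ` in `Diff^∞([0, ∞))`. -/
def centralizerOf (φ : halfLineDiff) : Subgroup halfLineDiff := Subgroup.centralizer {φ}

/-! The space `S_{φ,λ}` of solutions of the system of functional equations on `(0, ∞)`. -/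

/-- Extension by zero of a function on `(0, ∞)`. -/
noncomputable def extendZero (f : Set.Ioi (0 : ℝ) → ℂ) (t : ℝ) : ℂ :=
  open Classical in if h : 0 < t then f ⟨t, h⟩ else 0

theorem extendZero_of_pos (f : Set.Ioi (0 : ℝ) → ℂ) {t : ℝ} (h : 0 < t) :
    extendZero f t = f ⟨t, h⟩ := dif_pos h

/-- A complex-valued function on `(0, ∞)` is smooth. -/
def PosSmooth (f : Set.Ioi (0 : ℝ) → ℂ) : Prop := ContDiffOn ℝ ∞ (extendZero f) (Set.Ioi 0)

/-- The pairs `(β₁, β₂)` of smooth functions on `(0, ∞)` with `β₁ ∘ φ = λ β₁ + β₂` and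
`β₂ ∘ φ = λ β₂`. -/
noncomputable def solutionSpace (φ : halfLineDiff) (lam : ℂ) :
    Submodule ℂ ((Set.Ioi (0 : ℝ) → ℂ) × (Set.Ioi (0 : ℝ) → ℂ)) where
  carrier := {β | PosSmooth β.1 ∧ PosSmooth β.2 ∧
    (∀ x, β.1 (onPos φ x) = lam * β.1 x + β.2 x) ∧
    (∀ x, β.2 (onPos φ x) = lam * β.2 x)}
  add_mem' := by
    rintro a b ⟨a1, a2, a3, a4⟩ ⟨b1, b2, b3, b4⟩
    refine ⟨?_, ?_, ?_, ?_⟩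
    · refine (ContDiffOn.add a1 b1).congr ?_
      intro x hx
      simp [extendZero_of_pos _ hx]
    · refine (ContDiffOn.add a2 b2).congr ?_
      intro x hx
      simp [extendZero_of_pos _ hx]
    · intro x
      simp only [Prod.fst_add, Prod.snd_add, Pi.add_apply, a3, b3]
      ring
    · intro x
      simp only [Prod.snd_add, Pi.add_apply, a4, b4]
      ring
  zero_mem' := by
    have h : PosSmooth 0 := by
      refine (contDiffOn_const (c := (0 : ℂ))).congr ?_
      intro x hx
      simp [extendZero_of_pos _ hx]
    exact ⟨h, h, fun x => by simp, fun x => by simp⟩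
  smul_mem' := by
    rintro c a ⟨a1, a2, a3, a4⟩
    refine ⟨?_, ?_, ?_, ?_⟩
    · refine (contDiffOn_const (c := c) |>.mul a1).congr ?_
      intro x hx
      simp [extendZero_of_pos _ hx]
    · refine (contDiffOn_const (c := c) |>.mul a2).congr ?_
      intro x hx
      simp [extendZero_of_pos _ hx]
    · intro x
      simp only [Prod.smul_fst, Prod.smul_snd, Pi.smul_apply, smul_eq_mul, a3]
      ring
    · intro x
      simp only [Prod.smul_snd, Pi.smul_apply, smul_eq_mul, a4]
      ring

theorem PosSmooth.comp_onPos {f : Set.Ioi (0 : ℝ) → ℂ} (hf : PosSmooth f) (η : halfLineDiff) :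
    PosSmooth (fun x => f (onPos η x)) := by
  have h : ContDiffOn ℝ ∞ (fun t : ℝ => (η.1 t.toNNReal : ℝ)) (Set.Ioi 0) :=
    ContDiffOn.mono η.2.1 Set.Ioi_subset_Ici_self
  have hm : Set.MapsTo (fun t : ℝ => (η.1 t.toNNReal : ℝ)) (Set.Ioi 0) (Set.Ioi 0) :=
    fun t ht => NNReal.coe_pos.mpr ((pos_iff η _).mpr (Real.toNNReal_pos.mpr ht))
  refine (ContDiffOn.comp hf h hm).congr ?_
  intro t ht
  rw [extendZero_of_pos _ ht, Function.comp_apply, extendZero_of_pos _ (hm ht)]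
  congr 1
  apply Subtype.ext
  change ((η.1 ⟨t, _⟩ : ℝ≥0) : ℝ) = ((η.1 t.toNNReal : ℝ≥0) : ℝ)
  congr 2
  exact Subtype.ext (Real.coe_toNNReal t (le_of_lt ht)).symm

theorem onPos_comm {φ : halfLineDiff} (η : centralizerOf φ) (x : Set.Ioi (0 : ℝ)) :
    onPos η.1 (onPos φ x) = onPos φ (onPos η.1 x) := by
  have h : φ * η.1 = η.1 * φ := Subgroup.mem_centralizer_iff.mp η.2 φ rfl
  rw [← onPos_mul, ← onPos_mul, h]

/-- Precomposition `(β₁, β₂) ↦ (β₁ ∘ η, β₂ ∘ η)` for `η ∈ Z_φ`. -/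
noncomputable def precomp {φ : halfLineDiff} {lam : ℂ} (η : centralizerOf φ)
    (β : solutionSpace φ lam) : solutionSpace φ lam :=
  ⟨(fun x => β.1.1 (onPos η.1 x), fun x => β.1.2 (onPos η.1 x)),
    β.2.1.comp_onPos η.1, β.2.2.1.comp_onPos η.1,
    fun x => by simp only [onPos_comm, β.2.2.2.1],
    fun x => by simp only [onPos_comm, β.2.2.2.2]⟩

/-- The action of `Z_φ` on `S_{φ,λ}` by precomposition. Precomposition is a right action, so the
corresponding left action lets `η` act by `β ↦ β ∘ η⁻¹`. -/
noncomputable def precompAction (φ : halfLineDiff) (lam : ℂ) :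
    centralizerOf φ →* MulAut (Multiplicative (solutionSpace φ lam)) where
  toFun η :=
    { toFun := fun β => Multiplicative.ofAdd (precomp η⁻¹ β.toAdd)
      invFun := fun β => Multiplicative.ofAdd (precomp η β.toAdd)
      left_inv := fun β => by
        apply Multiplicative.toAdd.injective
        apply Subtype.ext
        refine Prod.ext (funext fun x => ?_) (funext fun x => ?_)
        · change β.toAdd.1.1 (onPos (η⁻¹).1 (onPos η.1 x)) = _
          rw [← onPos_mul, Subgroup.coe_inv, inv_mul_cancel, onPos_one]
        · change β.toAdd.1.2 (onPos (η⁻¹).1 (onPos η.1 x)) = _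
          rw [← onPos_mul, Subgroup.coe_inv, inv_mul_cancel, onPos_one]
      right_inv := fun β => by
        apply Multiplicative.toAdd.injective
        apply Subtype.ext
        refine Prod.ext (funext fun x => ?_) (funext fun x => ?_)
        · change β.toAdd.1.1 (onPos η.1 (onPos (η⁻¹).1 x)) = _
          rw [← onPos_mul, Subgroup.coe_inv, mul_inv_cancel, onPos_one]
        · change β.toAdd.1.2 (onPos η.1 (onPos (η⁻¹).1 x)) = _
          rw [← onPos_mul, Subgroup.coe_inv, mul_inv_cancel, onPos_one]
      map_mul' := fun _ _ => rfl }
  map_one' := rfl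
  map_mul' η θ := by
    ext β : 1
    apply Multiplicative.toAdd.injective
    apply Subtype.ext
    refine Prod.ext (funext fun x => ?_) (funext fun x => ?_)
    · change β.toAdd.1.1 (onPos ((η * θ)⁻¹).1 x) = β.toAdd.1.1 (onPos (θ⁻¹).1 (onPos (η⁻¹).1 x))
      rw [← onPos_mul, mul_inv_rev, Subgroup.coe_mul]
    · change β.toAdd.1.2 (onPos ((η * θ)⁻¹).1 x) = β.toAdd.1.2 (onPos (θ⁻¹).1 (onPos (η⁻¹).1 x))
      rw [← onPos_mul, mul_inv_rev, Subgroup.coe_mul]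

/-! The Hopf construction. -/

/-- The data of a Hopf construction: `T(z₁, z₂, x) = (λ z₁ + τ z₂ᵖ, μ z₂, φ(x))` with
`|λ| ≥ |μ| > 1`, `p ≥ 1`, `(λ - μᵖ) τ = 0` and `φ(x) > x` for `x > 0`. -/
structure HopfData where
  lam : ℂ
  mu : ℂ
  tau : ℂ
  p : ℕ
  φ : halfLineDiff
  one_lt_mu : 1 < ‖mu‖
  mu_le_lam : ‖mu‖ ≤ ‖lam‖
  p_pos : 0 < p
  resonance : (lam - mu ^ p) * tau = 0
  expanding : ∀ x : ℝ≥0, 0 < x → x < φ.1 x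

/-- `ℂ² × [0, ∞) \ {(O, 0)}` as a subset of `ℂ² × ℝ`. -/
def coverSet : Set ((ℂ × ℂ) × ℝ) := {q | 0 ≤ q.2 ∧ q ≠ 0}

/-- The space `ℂ² × [0, ∞) \ {(O, 0)}`. Its leaves are `ℂ² × {x}` for `x > 0` and
`(ℂ² \ {O}) × {0}`. -/
abbrev Cover : Type := coverSet

/-- The transverse coordinate `x` of `(z₁, z₂, x)`. -/
def height (q : Cover) : ℝ≥0 := ⟨q.1.2, q.2.1⟩

theorem mk_mem_coverSet {z : ℂ × ℂ} {x : ℝ} (hx : 0 < x) : (z, x) ∈ coverSet :=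
  ⟨hx.le, fun h => hx.ne' (congrArg Prod.snd h)⟩

/-- The point `(z, x)` for `z ∈ ℂ²` and `x > 0`. -/
def mkPos (z : ℂ × ℂ) (x : Set.Ioi (0 : ℝ)) : Cover := ⟨(z, x.1), mk_mem_coverSet x.2⟩

namespace HopfData

variable (D : HopfData)

theorem mu_ne_zero : D.mu ≠ 0 := norm_pos_iff.mp (one_pos.trans D.one_lt_mu)

theorem lam_ne_zero : D.lam ≠ 0 :=
  norm_pos_iff.mp (one_pos.trans (D.one_lt_mu.trans_le D.mu_le_lam))

/-- The diffeomorphism `T(z₁, z₂, x) = (λ z₁ + τ z₂ᵖ, μ z₂, φ(x))`. -/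
noncomputable def T : Equiv.Perm Cover where
  toFun q := ⟨((D.lam * q.1.1.1 + D.tau * q.1.1.2 ^ D.p, D.mu * q.1.1.2), (D.φ.1 (height q) : ℝ)),
    (D.φ.1 (height q)).2, fun h => q.2.2 (by
      have h2 : D.mu * q.1.1.2 = 0 := congrArg (fun q => q.1.2) h
      have h3 : ((D.φ.1 (height q) : ℝ≥0) : ℝ) = 0 := congrArg Prod.snd h
      have h4 : q.1.1.2 = 0 := (mul_eq_zero.mp h2).resolve_left D.mu_ne_zero
      have h1 : D.lam * q.1.1.1 + D.tau * q.1.1.2 ^ D.p = 0 := congrArg (fun q => q.1.1) h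
      rw [h4, zero_pow D.p_pos.ne', mul_zero, add_zero] at h1
      have h5 : height q = 0 := by
        have := pos_iff D.φ (height q)
        rw [pos_iff_ne_zero, pos_iff_ne_zero, not_iff_not] at this
        exact this.mp (NNReal.coe_eq_zero.mp h3)
      exact Prod.ext (Prod.ext ((mul_eq_zero.mp h1).resolve_left D.lam_ne_zero) h4)
        (congrArg NNReal.toReal h5))⟩
  invFun q := ⟨(((q.1.1.1 - D.tau * (q.1.1.2 / D.mu) ^ D.p) / D.lam, q.1.1.2 / D.mu),
      (D.φ.1.symm (height q) : ℝ)),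
    (D.φ.1.symm (height q)).2, fun h => q.2.2 (by
      have h2 : q.1.1.2 / D.mu = 0 := congrArg (fun q => q.1.2) h
      have h3 : ((D.φ.1.symm (height q) : ℝ≥0) : ℝ) = 0 := congrArg Prod.snd h
      have h4 : q.1.1.2 = 0 := (div_eq_zero_iff.mp h2).resolve_right D.mu_ne_zero
      have h1 : (q.1.1.1 - D.tau * (q.1.1.2 / D.mu) ^ D.p) / D.lam = 0 :=
        congrArg (fun q => q.1.1) h
      rw [h2, zero_pow D.p_pos.ne', mul_zero, sub_zero] at h1
      have h5 : height q = 0 := by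
        have h6 := NNReal.coe_eq_zero.mp h3
        rw [Equiv.symm_apply_eq, map_zero_of_mem] at h6
        exact h6
      exact Prod.ext (Prod.ext ((div_eq_zero_iff.mp h1).resolve_right D.lam_ne_zero) h4)
        (congrArg NNReal.toReal h5))⟩
  left_inv q := by
    have h1 := D.mu_ne_zero
    have h2 := D.lam_ne_zero
    apply Subtype.ext
    refine Prod.ext (Prod.ext ?_ ?_) ?_
    · simp [h1, h2]
    · simp [h1]
    · change ((D.φ.1.symm (D.φ.1 (height q)) : ℝ≥0) : ℝ) = _
      rw [Equiv.symm_apply_apply]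
      rfl
  right_inv q := by
    have h1 := D.mu_ne_zero
    have h2 := D.lam_ne_zero
    apply Subtype.ext
    refine Prod.ext (Prod.ext ?_ ?_) ?_
    · change D.lam * ((q.1.1.1 - D.tau * (q.1.1.2 / D.mu) ^ D.p) / D.lam)
        + D.tau * (q.1.1.2 / D.mu) ^ D.p = q.1.1.1
      rw [mul_div_cancel₀ _ h2, sub_add_cancel]
    · change D.mu * (q.1.1.2 / D.mu) = q.1.1.2
      rw [mul_div_cancel₀ _ h1]
    · change ((D.φ.1 (D.φ.1.symm (height q)) : ℝ≥0) : ℝ) = _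
      rw [Equiv.apply_symm_apply]
      rfl

/-- The Reeb component `R`: the quotient of `ℂ² × [0, ∞) \ {(O, 0)}` by the group `T^ℤ`. -/
def Reeb : Type := MulAction.orbitRel.Quotient (Subgroup.zpowers D.T) Cover

/-- The covering projection onto `R`. The charts of `R` are its local inverses. -/
noncomputable def proj (q : Cover) : D.Reeb := Quotient.mk (MulAction.orbitRel (Subgroup.zpowers D.T) Cover) q

/-- The leaves of `R` are the images of the leaves upstairs. -/
def IsLeaf (L : Set D.Reeb) : Prop := ∃ x : ℝ≥0, L = D.proj '' {q | height q = x}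

/-- The boundary leaf `H`, a primary Hopf surface. -/
def boundary : Set D.Reeb := D.proj '' {q | height q = 0}

variable {D}

/-- A self-map `f` of `R` is smooth and leafwise holomorphic: read in the charts of `R`, that is,
lifted locally through the covering projection, it is a map `G` which is smooth (up to the
boundary), whose transverse coordinate depends on the transverse coordinate only, and which is
holomorphic in `z ∈ ℂ²` for fixed transverse coordinate. In particular `f` is continuous. -/
def IsLeafwiseHolomorphic (f : D.Reeb → D.Reeb) : Prop :=
  ∀ q₀ : Cover, ∃ (U : Set ((ℂ × ℂ) × ℝ)) (G : (ℂ × ℂ) × ℝ → (ℂ × ℂ) × ℝ),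
    IsOpen U ∧ q₀.1 ∈ U ∧
    (∀ q : Cover, q.1 ∈ U → ∃ h : G q.1 ∈ coverSet, f (D.proj q) = D.proj ⟨G q.1, h⟩) ∧
    ContDiffOn ℝ ∞ G (U ∩ coverSet) ∧
    (∀ q ∈ U ∩ coverSet, ∀ q' ∈ U ∩ coverSet, q.2 = q'.2 → (G q).2 = (G q').2) ∧
    (∀ q ∈ U ∩ coverSet, DifferentiableAt ℂ (fun z : ℂ × ℂ => (G (z, q.2)).1) q.1)

theorem IsLeafwiseHolomorphic.id : IsLeafwiseHolomorphic (D := D) (fun r => r) := fun _ =>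
  ⟨Set.univ, fun q => q, isOpen_univ, trivial, fun q _ => ⟨q.2, rfl⟩, contDiffOn_id,
    fun _ _ _ _ h => h, fun _ _ => differentiableAt_id⟩

/-- Points of a leaf near a given point of the leaf stay in the cover. -/
theorem eventually_mem_coverSet {q : (ℂ × ℂ) × ℝ} (hq : q ∈ coverSet) :
    ∀ᶠ z in nhds q.1, (z, q.2) ∈ coverSet := by
  have hc : Continuous fun z : ℂ × ℂ => (z, q.2) := by fun_prop
  have hne : ∀ᶠ z in nhds q.1, (z, q.2) ≠ 0 :=
    hc.continuousAt.eventually_ne hq.2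
  filter_upwards [hne] with z hz
  exact ⟨hq.1, hz⟩

theorem IsLeafwiseHolomorphic.comp {f g : D.Reeb → D.Reeb} (hf : IsLeafwiseHolomorphic f)
    (hg : IsLeafwiseHolomorphic g) : IsLeafwiseHolomorphic (f ∘ g) := by
  intro q₀
  obtain ⟨U, G, hU, hq₀, hG, hGs, hGx, hGz⟩ := hg q₀
  obtain ⟨hm, -⟩ := hG q₀ hq₀
  obtain ⟨V, F, hV, hq₁, hF, hFs, hFx, hFz⟩ := hf ⟨G q₀.1, hm⟩
  obtain ⟨W, hW, hWV⟩ := continuousOn_iff'.mp hGs.continuousOn V hV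
  have key : ∀ q ∈ (U ∩ W) ∩ coverSet, q ∈ U ∩ coverSet ∧ G q ∈ V ∩ coverSet := by
    rintro q ⟨⟨hqU, hqW⟩, hqc⟩
    have h1 : q ∈ G ⁻¹' V ∩ (U ∩ coverSet) := by
      rw [hWV]
      exact ⟨hqW, hqU, hqc⟩
    exact ⟨⟨hqU, hqc⟩, h1.1, (hG ⟨q, hqc⟩ hqU).1⟩
  have hq₀W : q₀.1 ∈ W := by
    have h1 : q₀.1 ∈ G ⁻¹' V ∩ (U ∩ coverSet) := ⟨hq₁, hq₀, q₀.2⟩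
    rw [hWV] at h1
    exact h1.1
  refine ⟨U ∩ W, F ∘ G, hU.inter hW, ⟨hq₀, hq₀W⟩, ?_, ?_, ?_, ?_⟩
  · intro q hq
    obtain ⟨h1, h2⟩ := hG q hq.1
    obtain ⟨h3, h4⟩ := hF ⟨G q.1, h1⟩ (key q.1 ⟨hq, q.2⟩).2.1
    exact ⟨h3, by rw [Function.comp_apply, h2, h4]; rfl⟩
  · exact ContDiffOn.comp hFs (hGs.mono fun q hq => (key q hq).1) fun q hq => (key q hq).2
  · intro q hq q' hq' h
    exact hFx _ (key q hq).2 _ (key q' hq').2 (hGx _ (key q hq).1 _ (key q' hq').1 h)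
  · intro q hq
    have h1 := hGz q (key q hq).1
    have h2 := hFz (G q) (key q hq).2
    have h3 : DifferentiableAt ℂ (fun z : ℂ × ℂ => (F ((G (z, q.2)).1, (G q).2)).1) q.1 :=
      DifferentiableAt.comp q.1 (g := fun w : ℂ × ℂ => (F (w, (G q).2)).1) h2 h1
    refine h3.congr_of_eventuallyEq ?_
    have hc : Continuous fun z : ℂ × ℂ => (z, q.2) := by fun_prop
    have hUn : ∀ᶠ z in nhds q.1, (z, q.2) ∈ U :=
      hc.continuousAt.eventually (hU.mem_nhds hq.1.1)
    filter_upwards [hUn, eventually_mem_coverSet hq.2] with z hz hzc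
    have h4 : (G (z, q.2)).2 = (G q).2 := hGx _ ⟨hz, hzc⟩ _ (key q hq).1 rfl
    rw [Function.comp_apply, ← h4]

variable (D)

/-- The group `Aut R` of leafwise holomorphic smooth automorphisms: the bijections of `R` which
are smooth and leafwise holomorphic together with their inverses and map leaves to leaves. -/
def autR : Subgroup (Equiv.Perm D.Reeb) where
  carrier := {f | IsLeafwiseHolomorphic f ∧ IsLeafwiseHolomorphic f.symm ∧
    ∀ L : Set D.Reeb, D.IsLeaf (f '' L) ↔ D.IsLeaf L}
  mul_mem' := by
    rintro f g ⟨f1, f2, f3⟩ ⟨g1, g2, g3⟩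
    refine ⟨f1.comp g1, g2.comp f2, fun L => ?_⟩
    rw [← g3 L, ← f3 (g '' L), Set.image_image]
    rfl
  one_mem' := ⟨IsLeafwiseHolomorphic.id, IsLeafwiseHolomorphic.id, fun L => by simp⟩
  inv_mem' := by
    rintro f ⟨f1, f2, f3⟩
    refine ⟨f2, f1, fun L => ?_⟩
    change D.IsLeaf (f.symm '' L) ↔ _
    rw [← f3 (f.symm '' L), Set.image_image]
    simp

/-- The group `Aut(R, H)`: the kernel of the restriction of `Aut R` to the boundary `H`, that is,
the automorphisms which fix every point of `H`. -/
def autRH : Subgroup D.autR := fixingSubgroup D.autR D.boundary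

end HopfData

end LCReeb

/-! The relation `(λ - μ^p) τ = 0` with `τ = 1` and `λ = μ` forces `p = 1`, so `T` acts on `ℂ²` by
the Jordan block `J` with eigenvalue `λ` and on the half line by `φ`. Everything is then done on the
simply connected cover. A pair `(β, η)` acts there by `(z, x) ↦ (z + β(η x), η x)`. The two
functional equations say exactly that `β ∘ φ = J β`, so this map commutes with `T` and descends to
`R`. What has to be proved is that it is smooth up to the boundary, and that every automorphism
fixing `H` arises in this way.

Smoothness. Going towards `0`, a solution is divided by `λ` at each step, which makes it tend to
`0`. Differentiating the functional equation gives an equation of the same type, whose coefficient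
at `0` is multiplied by `φ'(0) = 1`; induction then controls all derivatives
(`contDiffOn_Ici_of_functional_equation`).

Infinite dimension. A smooth function supported in the fundamental domain `(1, φ 1)` extends
uniquely to a solution of `β ∘ φ = λ β`, and `(β, 0)` lies in the solution space.

Surjectivity. An automorphism fixing `H` lifts to a map `F` of the cover that is the identity at
height `0` and commutes with `T`; its height component is some `η` in the centralizer of `φ`. The
displacement `g x z`, the `ℂ²` part of `F (z, x)` minus `z`, is entire in `z`, satisfies `g (φ x) (J
z) = J (g x z)`, and is small near the boundary. Pulling back by `T⁻ⁿ` shows that `g x` grows less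
than quadratically, hence is affine; its linear part is reduced to `φ`-invariant functions tending
to `0`, hence vanishes (`eq_const_of_equivariant`). So `F` is a translation on each leaf, and the
translation vector satisfies the functional equations. Injectivity is the uniqueness of lifts. -/

namespace LCReeb

open Filter Topology Set

/-! ### Functional equations on the half line and smoothness at the fixed point -/

/-- A diffeomorphism of `[0, ∞)`, extended to the real line. -/
noncomputable def realMap (η : halfLineDiff) (t : ℝ) : ℝ := (η.1 t.toNNReal : ℝ)

theorem realMap_coe (η : halfLineDiff) (x : ℝ≥0) : realMap η x = η.1 x := by
  simp [realMap]

theorem realMap_pos (η : halfLineDiff) {t : ℝ} (ht : 0 < t) : 0 < realMap η t :=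
  NNReal.coe_pos.mpr ((pos_iff η _).mpr (Real.toNNReal_pos.mpr ht))

theorem realMap_nonneg (η : halfLineDiff) (t : ℝ) : 0 ≤ realMap η t := NNReal.coe_nonneg _

theorem realMap_zero (η : halfLineDiff) : realMap η 0 = 0 := by
  simp [realMap, map_zero_of_mem]

theorem contDiffOn_realMap (η : halfLineDiff) : ContDiffOn ℝ ∞ (realMap η) (Ici 0) := η.2.1

theorem continuous_realMap (η : halfLineDiff) : Continuous (realMap η) :=
  NNReal.continuous_coe.comp (η.2.1.continuous.comp continuous_real_toNNReal)

theorem coe_onPos (η : halfLineDiff) (x : Ioi (0 : ℝ)) : (onPos η x : ℝ) = realMap η x :=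
  (realMap_coe η ⟨x.1, le_of_lt x.2⟩).symm

theorem strictMono_of_mem (η : halfLineDiff) : StrictMono η.1 := by
  rcases η.2.1.continuous.strictMono_of_inj η.1.injective with h | h
  · exact h
  · have h1 := h one_pos
    rw [map_zero_of_mem] at h1
    exact absurd h1 not_lt_zero

section Expanding

variable {φ : halfLineDiff} (hφ : ∀ x : ℝ≥0, 0 < x → x < φ.1 x)
include hφ

theorem inv_lt_self_of_pos {x : ℝ≥0} (hx : 0 < x) : φ.1.symm x < x := by
  have h := hφ (φ.1.symm x) (by
    rw [← pos_iff φ]; simpa using hx)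
  simpa using h

theorem inv_le_self (x : ℝ≥0) : φ.1.symm x ≤ x := by
  rcases eq_or_ne x 0 with rfl | hx
  · exact (map_zero_of_mem φ⁻¹).le
  · exact (inv_lt_self_of_pos hφ (pos_iff_ne_zero.mpr hx)).le

/-- The backward orbit decreases, and its limit is a fixed point of `φ⁻¹`; the only fixed point is
`0`. -/
theorem tendsto_iterate_inv (x : ℝ≥0) : Tendsto (fun n => φ.1.symm^[n] x) atTop (𝓝 0) := by
  have ha : Antitone (fun n => φ.1.symm^[n] x) := antitone_nat_of_succ_le fun n => by
    rw [Function.iterate_succ_apply']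
    exact inv_le_self hφ _
  have hl := tendsto_atTop_ciInf ha (OrderBot.bddBelow _)
  set l := ⨅ n, φ.1.symm^[n] x with hldef
  have hc : Continuous φ.1.symm := φ.2.2.continuous
  have h1 : Tendsto (fun n => φ.1.symm^[n + 1] x) atTop (𝓝 (φ.1.symm l)) := by
    simp_rw [Function.iterate_succ_apply']
    exact (hc.tendsto l).comp hl
  have h2 := tendsto_nhds_unique h1 (hl.comp (tendsto_add_atTop_nat 1))
  rcases eq_or_ne l 0 with h | h
  · rwa [h] at hl
  · exact absurd h2 (inv_lt_self_of_pos hφ (pos_iff_ne_zero.mpr h)).ne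

theorem exists_lt_iterate {x : ℝ≥0} (hx : 0 < x) (M : ℝ≥0) :
    ∃ N, ∀ n, N ≤ n → M < φ.1^[n] x := by
  obtain ⟨N, hN⟩ := eventually_atTop.mp ((tendsto_iterate_inv hφ M).eventually_lt_const hx)
  refine ⟨N, fun n hn => ?_⟩
  have h := (strictMono_of_mem φ).iterate n (hN n hn)
  rwa [(Function.RightInverse.iterate φ.1.apply_symm_apply n) M] at h

/-- A function which is almost contracted by the pull back along an expanding diffeomorphism
tends to zero at the fixed point. -/
theorem tendsto_zero_of_contraction {E : Type*} [NormedAddCommGroup E] {y : ℝ → E}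
    (hy : ContinuousOn y (Ioi 0)) {ρ : ℝ} (hρ0 : 0 ≤ ρ) (hρ : ρ < 1) {ε : ℝ → ℝ}
    (hε : Tendsto ε (𝓝[>] 0) (𝓝 0))
    (h : ∀ᶠ x in 𝓝[>] 0, ‖y x‖ ≤ ρ * ‖y (realMap φ x)‖ + ε x) :
    Tendsto y (𝓝[>] 0) (𝓝 0) := by
  rw [tendsto_zero_iff_norm_tendsto_zero, Metric.tendsto_nhds]
  intro r hr
  have hs : 0 < (1 - ρ) * (r / 2) := by nlinarith
  obtain ⟨δ, hδ0, hδ⟩ := mem_nhdsGT_iff_exists_Ioc_subset.mp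
    (h.and (hε.eventually_le_const hs))
  rw [mem_Ioi] at hδ0
  set d : ℝ≥0 := ⟨δ, hδ0.le⟩ with hd
  have hd0 : 0 < d := hδ0
  -- Truncating at `r / 2` absorbs the error: since `ε x ≤ (1 - ρ) * (r / 2)` near `0`, the function
  -- `w` satisfies the contraction inequality with no error term.
  set w : ℝ≥0 → ℝ := fun x => max (‖y x‖ - r / 2) 0 with hw
  have hw0 : ∀ x, 0 ≤ w x := fun x => le_max_right _ _
  have hstep : ∀ x : ℝ≥0, 0 < x → x ≤ d → w x ≤ ρ * w (φ.1 x) := by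
    intro x hx hxd
    obtain ⟨h1, h2⟩ := hδ (⟨hx, hxd⟩ : (x : ℝ) ∈ Ioc 0 δ)
    rw [realMap_coe] at h1
    refine max_le ?_ (mul_nonneg hρ0 (hw0 _))
    have h3 : ‖y (φ.1 x)‖ - r / 2 ≤ w (φ.1 x) := le_max_left _ _
    nlinarith
  -- Every forward orbit starting in `(0, d]` meets the compact interval `[d, φ d]`, so a bound for
  -- `w` there is a bound on all of `(0, d]`.
  have hwc : ContinuousOn w (Icc d (φ.1 d)) := by
    refine ContinuousOn.sup (ContinuousOn.sub ?_ continuousOn_const) continuousOn_const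
    refine (hy.comp NNReal.continuous_coe.continuousOn fun x hx => ?_).norm
    exact hd0.trans_le hx.1
  obtain ⟨B, hB⟩ := (isCompact_Icc.bddAbove_image hwc)
  have hB1 : ∀ x, d ≤ x → x ≤ φ.1 d → w x ≤ B := fun x h1 h2 => hB ⟨x, ⟨h1, h2⟩, rfl⟩
  have hB0 : 0 ≤ B := (hw0 d).trans (hB1 d le_rfl (hφ d hd0).le)
  have hB2 : ∀ N, ∀ x : ℝ≥0, 0 < x → x ≤ d → d ≤ φ.1^[N] x → w x ≤ B := by
    intro N
    induction N with
    | zero => exact fun x _ h1 h2 => hB1 x h2 (h1.trans (hφ d hd0).le)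
    | succ N ih =>
      intro x hx hxd hN
      have h1 := hstep x hx hxd
      have h2 : w (φ.1 x) ≤ B := by
        rcases le_total (φ.1 x) d with h2 | h2
        · exact ih _ ((pos_iff φ x).mpr hx) h2 hN
        · exact hB1 _ h2 ((strictMono_of_mem φ).monotone hxd)
      nlinarith [hw0 (φ.1 x)]
  have hB3 : ∀ x : ℝ≥0, 0 < x → x ≤ d → w x ≤ B := fun x hx hxd => by
    obtain ⟨N, hN⟩ := exists_lt_iterate hφ hx d
    exact hB2 N x hx hxd (hN N le_rfl).le
  -- Points close enough to `0` stay below `d` for `n` steps and gain a factor `ρ` at each of them.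
  have hB4 : ∀ n, ∀ x : ℝ≥0, 0 < x → φ.1^[n] x ≤ d → w x ≤ ρ ^ n * B := by
    intro n
    induction n with
    | zero => intro x hx h1; simpa using hB3 x hx h1
    | succ n ih =>
      intro x hx h1
      have h2 : x ≤ d := by
        refine le_trans ?_ h1
        exact Function.id_le_iterate_of_id_le
          (fun x => by
            rcases eq_or_ne x 0 with rfl | hx
            · exact zero_le
            · exact (hφ x (pos_iff_ne_zero.mpr hx)).le) (n + 1) x
      have h3 := ih (φ.1 x) ((pos_iff φ x).mpr hx) h1
      have h4 := hstep x hx h2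
      calc w x ≤ ρ * w (φ.1 x) := h4
        _ ≤ ρ * (ρ ^ n * B) := mul_le_mul_of_nonneg_left h3 hρ0
        _ = ρ ^ (n + 1) * B := by ring
  have hlim : Tendsto (fun n => ρ ^ n * B) atTop (𝓝 0) := by
    simpa using (tendsto_pow_atTop_nhds_zero_of_lt_one hρ0 hρ).mul_const B
  obtain ⟨n, hn⟩ := (hlim.eventually_lt_const (half_pos hr)).exists
  have hcont : Continuous fun t : ℝ => φ.1^[n] t.toNNReal :=
    (φ.2.1.continuous.iterate n).comp continuous_real_toNNReal
  have hz : φ.1^[n] (0 : ℝ).toNNReal = 0 := by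
    rw [Real.toNNReal_zero]
    exact Function.iterate_fixed (map_zero_of_mem φ) n
  have hev : ∀ᶠ t : ℝ in 𝓝[>] 0, φ.1^[n] t.toNNReal < d := by
    refine (hcont.tendsto 0).mono_left nhdsWithin_le_nhds |>.eventually_lt_const ?_
    rw [hz]; exact hd0
  filter_upwards [hev, self_mem_nhdsWithin] with t ht ht0
  have h1 := hB4 n t.toNNReal (Real.toNNReal_pos.mpr ht0) ht.le
  have h2 : ‖y (t.toNNReal : ℝ)‖ - r / 2 ≤ w t.toNNReal := le_max_left _ _
  rw [Real.coe_toNNReal t (le_of_lt ht0)] at h2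
  rw [Real.dist_0_eq_abs, abs_of_nonneg (norm_nonneg _)]
  linarith

/-- The limit is forced by putting `x = 0` in the equation, and `u - c` is contracted up to an error
tending to `0`, with factor `r / ‖lam‖` for any `r` strictly between `‖m 0‖` and `‖lam‖`. -/
theorem exists_tendsto_of_functional_equation {lam : ℂ} {u m e : ℝ → ℂ}
    (hu : ContinuousOn u (Ioi 0)) (hm : ContinuousOn m (Ici 0)) (he : ContinuousOn e (Ici 0))
    (hm0 : ‖m 0‖ < ‖lam‖)
    (h : ∀ x, 0 < x → lam * u x = m x * u (realMap φ x) + e x) :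
    ∃ c, Tendsto u (𝓝[>] 0) (𝓝 c) ∧ (lam - m 0) * c = e 0 := by
  have hne : lam - m 0 ≠ 0 := by
    intro h0
    rw [sub_eq_zero.mp h0] at hm0
    exact lt_irrefl _ hm0
  have hlam : 0 < ‖lam‖ := (norm_nonneg _).trans_lt hm0
  set c := e 0 / (lam - m 0) with hc
  have hc1 : (lam - m 0) * c = e 0 := mul_div_cancel₀ _ hne
  refine ⟨c, ?_, hc1⟩
  have hmlim : Tendsto m (𝓝[>] 0) (𝓝 (m 0)) :=
    (hm 0 self_mem_Ici).mono_left (nhdsWithin_mono 0 Ioi_subset_Ici_self)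
  have helim : Tendsto e (𝓝[>] 0) (𝓝 (e 0)) :=
    (he 0 self_mem_Ici).mono_left (nhdsWithin_mono 0 Ioi_subset_Ici_self)
  obtain ⟨r, hr1, hr2⟩ := exists_between hm0
  have hr0 : 0 ≤ r := (norm_nonneg _).trans hr1.le
  suffices h0 : Tendsto (fun x => u x - c) (𝓝[>] 0) (𝓝 0) by
    simpa using h0.add_const c
  refine tendsto_zero_of_contraction hφ (hu.sub continuousOn_const)
    (ρ := r / ‖lam‖) (by positivity) ((div_lt_one hlam).mpr hr2)
    (ε := fun x => ‖m x * c + e x - lam * c‖ / ‖lam‖) ?_ ?_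
  · have : Tendsto (fun x => ‖m x * c + e x - lam * c‖ / ‖lam‖) (𝓝[>] 0)
        (𝓝 (‖m 0 * c + e 0 - lam * c‖ / ‖lam‖)) :=
      (((hmlim.mul_const c).add helim).sub_const _).norm.div_const _
    have h0 : m 0 * c + e 0 - lam * c = 0 := by rw [← hc1]; ring
    rwa [h0, norm_zero, zero_div] at this
  · filter_upwards [self_mem_nhdsWithin, hmlim.norm.eventually_le_const hr1] with x hx hmx
    have h1 : lam * (u x - c) = m x * (u (realMap φ x) - c) + (m x * c + e x - lam * c) := by
      rw [mul_sub, h x hx]; ring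
    have h2 : ‖lam‖ * ‖u x - c‖ ≤ r * ‖u (realMap φ x) - c‖ + ‖m x * c + e x - lam * c‖ := by
      rw [← norm_mul, h1]
      refine (norm_add_le _ _).trans (add_le_add_left ?_ _)
      rw [norm_mul]
      exact mul_le_mul_of_nonneg_right hmx (norm_nonneg _)
    rw [div_mul_eq_mul_div, ← add_div, le_div_iff₀ hlam, mul_comm]
    exact h2

end Expanding

theorem derivWithin_realMap_zero {φ : halfLineDiff} (h : InfinitelyTangentToId φ) :
    derivWithin (realMap φ) (Ici 0) 0 = 1 := by
  have h1 := h 1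
  rw [iteratedDerivWithin_one] at h1
  have hd : DifferentiableWithinAt ℝ (realMap φ) (Ici 0) 0 :=
    ((contDiffOn_realMap φ).differentiableOn (by simp)) 0 self_mem_Ici
  have hu : UniqueDiffWithinAt ℝ (Ici (0 : ℝ)) 0 := uniqueDiffOn_Ici 0 0 self_mem_Ici
  have h2 := ((hd.hasDerivWithinAt.sub (hasDerivWithinAt_id 0 (Ici 0))).derivWithin hu)
  change derivWithin (fun t : ℝ => (φ.1 t.toNNReal : ℝ) - t) (Ici 0) 0 = _ at h2
  rw [h1] at h2
  linarith

/-- The variable coefficient `m` makes the class of equations stable under differentiation: `u'`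
satisfies one with coefficient `m φ'` and inhomogeneous term `m' (u ∘ φ) + e'`. As `φ' 0 = 1`, the
condition `‖m 0‖ < ‖lam‖` persists. The new term contains `u` itself, known to be only `C^k` by
induction, which is why `e` is assumed `C^k` and not smooth. -/
theorem contDiffOn_Ici_of_functional_equation {φ : halfLineDiff}
    (hφ : ∀ x : ℝ≥0, 0 < x → x < φ.1 x) (ht : InfinitelyTangentToId φ) {lam : ℂ} (k : ℕ) :
    ∀ {u m e : ℝ → ℂ} {c : ℂ}, ContDiffOn ℝ ∞ u (Ioi 0) → ContDiffOn ℝ ∞ m (Ici 0) →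
    ContDiffOn ℝ k e (Ici 0) → ‖m 0‖ < ‖lam‖ →
    (∀ x, 0 < x → lam * u x = m x * u (realMap φ x) + e x) →
    Tendsto u (𝓝[>] 0) (𝓝 c) → ContDiffOn ℝ k (Function.update u 0 c) (Ici 0) := by
  have heq : ∀ (u : ℝ → ℂ) (c : ℂ), EqOn (Function.update u 0 c) u (Ioi 0) := fun u c x hx =>
    Function.update_of_ne (ne_of_gt hx) _ _
  have hcont : ∀ {u : ℝ → ℂ} {c : ℂ}, ContinuousOn u (Ioi 0) → Tendsto u (𝓝[>] 0) (𝓝 c) →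
      ContinuousOn (Function.update u 0 c) (Ici 0) := by
    intro u c hu hc
    refine continuousOn_update_iff.mpr ⟨hu.mono ?_, fun _ => ?_⟩
    · rintro x ⟨hx, hx0⟩
      exact lt_of_le_of_ne hx (Ne.symm hx0)
    · rwa [Ici_sdiff_left]
  have hud : UniqueDiffOn ℝ (Ici (0 : ℝ)) := uniqueDiffOn_Ici 0
  induction k with
  | zero =>
    intro u m e c hu _ _ _ _ hc
    exact contDiffOn_zero.mpr (hcont hu.continuousOn hc)
  | succ k ih =>
    intro u m e c hu hm he hm0 h hc
    have hek := (contDiffOn_succ_iff_derivWithin (n := (k : ℕ)) hud).mp (by exact_mod_cast he)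
    have hũ := ih hu hm (he.of_le (by exact_mod_cast k.le_succ)) hm0 h hc
    set v := Function.update u 0 c with hv
    have hmaps : MapsTo (realMap φ) (Ici 0) (Ici 0) := fun x _ => realMap_nonneg φ x
    have hm' : ContDiffOn ℝ ∞ (derivWithin m (Ici 0)) (Ici 0) :=
      ((contDiffOn_infty_iff_derivWithin hud).mp hm).2
    have hφ' : ContDiffOn ℝ ∞ (derivWithin (realMap φ) (Ici 0)) (Ici 0) :=
      ((contDiffOn_infty_iff_derivWithin hud).mp (contDiffOn_realMap φ)).2
    have hu' : ContDiffOn ℝ ∞ (deriv u) (Ioi 0) :=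
      ((contDiffOn_infty_iff_deriv_of_isOpen isOpen_Ioi).mp hu).2
    set m₁ : ℝ → ℂ := fun x => m x * ((derivWithin (realMap φ) (Ici 0) x : ℝ) : ℂ) with hm₁
    set e₁ : ℝ → ℂ := fun x => derivWithin m (Ici 0) x * v (realMap φ x) +
      derivWithin e (Ici 0) x with he₁
    have hm₁s : ContDiffOn ℝ ∞ m₁ (Ici 0) :=
      hm.mul (Complex.ofRealCLM.contDiff.comp_contDiffOn hφ')
    have he₁s : ContDiffOn ℝ k e₁ (Ici 0) :=
      ((hm'.of_le (by exact_mod_cast le_top)).mul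
        (hũ.comp ((contDiffOn_realMap φ).of_le (by exact_mod_cast le_top)) hmaps)).add hek.2.2
    have hm₁0 : ‖m₁ 0‖ < ‖lam‖ := by
      simpa [hm₁, derivWithin_realMap_zero ht] using hm0
    have h₁ : ∀ x, 0 < x → lam * deriv u x = m₁ x * deriv u (realMap φ x) + e₁ x := by
      intro x hx
      have hn : Ici (0 : ℝ) ∈ 𝓝 x := Ici_mem_nhds hx
      have d1 : HasDerivAt u (deriv u x) x :=
        ((hu.differentiableOn (by simp)).differentiableAt (Ioi_mem_nhds hx)).hasDerivAt
      have d2 : HasDerivAt u (deriv u (realMap φ x)) (realMap φ x) :=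
        ((hu.differentiableOn (by simp)).differentiableAt
          (Ioi_mem_nhds (realMap_pos φ hx))).hasDerivAt
      have d3 : HasDerivAt m (derivWithin m (Ici 0) x) x :=
        ((hm.differentiableOn (by simp)) x hx.le).hasDerivWithinAt.hasDerivAt hn
      have d4 : HasDerivAt e (derivWithin e (Ici 0) x) x :=
        ((he.differentiableOn (by simp)) x hx.le).hasDerivWithinAt.hasDerivAt hn
      have d5 : HasDerivAt (realMap φ) (derivWithin (realMap φ) (Ici 0) x) x :=
        (((contDiffOn_realMap φ).differentiableOn (by simp)) x hx.le).hasDerivWithinAt.hasDerivAt hn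
      have d6 := ((d3.mul (d2.scomp x d5)).add d4)
      have d7 := d1.const_mul lam
      have hev : (fun x => lam * u x) =ᶠ[𝓝 x] (m * (u ∘ realMap φ) + e) := by
        filter_upwards [Ioi_mem_nhds hx] with t ht
        exact h t ht
      have := (d6.congr_of_eventuallyEq hev).unique d7
      rw [← this]
      simp only [hm₁, he₁, hv, Function.comp_apply, Complex.real_smul,
        Function.update_of_ne (realMap_pos φ hx).ne']
      ring
    obtain ⟨c', hc', -⟩ := exists_tendsto_of_functional_equation hφ hu'.continuousOn
      hm₁s.continuousOn he₁s.continuousOn hm₁0 h₁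
    have hw := ih hu' hm₁s he₁s hm₁0 h₁ hc'
    have hvIoi : ContDiffOn ℝ ∞ v (Ioi 0) := hu.congr (heq u c)
    have hderivv : ∀ x, 0 < x → deriv v x = deriv u x := fun x hx =>
      Filter.EventuallyEq.deriv_eq (by
        filter_upwards [Ioi_mem_nhds hx] with t ht using heq u c ht)
    -- A continuous function whose derivative has a limit at the endpoint is differentiable there,
    -- with that limit as derivative.
    have hd0 : HasDerivWithinAt v c' (Ici 0) 0 := by
      refine hasDerivWithinAt_Ici_of_tendsto_deriv (s := Ioi 0)
        (hvIoi.differentiableOn (by simp)) ?_ self_mem_nhdsWithin ?_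
      · exact (hũ.continuousOn 0 self_mem_Ici).mono Ioi_subset_Ici_self
      · refine hc'.congr' ?_
        filter_upwards [self_mem_nhdsWithin] with x hx using (hderivv x hx).symm
    have hdw : ∀ x ∈ Ici (0 : ℝ), HasDerivWithinAt v (Function.update (deriv u) 0 c' x) (Ici 0) x := by
      intro x hx
      rcases eq_or_lt_of_le (show (0 : ℝ) ≤ x from hx) with rfl | hx
      · simpa using hd0
      · rw [Function.update_of_ne hx.ne', ← hderivv x hx]
        exact ((hvIoi.differentiableOn (by simp)).differentiableAt
          (Ioi_mem_nhds hx)).hasDerivAt.hasDerivWithinAt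
    have : ContDiffOn ℝ ((k : ℕ) + 1 : WithTop ℕ∞) v (Ici 0) := by
      refine (contDiffOn_succ_iff_derivWithin hud).mpr
        ⟨fun x hx => (hdw x hx).differentiableWithinAt, ?_, ?_⟩
      · intro h0; simp at h0
      · exact hw.congr fun x hx => (hdw x hx).derivWithin (hud x hx)
    exact_mod_cast this

/-- Solutions of `λ u = u ∘ φ + e`, where `|λ| > 1` and `e` vanishes at `0`, extend smoothly by
zero. -/
theorem contDiffOn_Ici_of_eq_comp_add {φ : halfLineDiff}
    (hφ : ∀ x : ℝ≥0, 0 < x → x < φ.1 x) (ht : InfinitelyTangentToId φ) {lam : ℂ}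
    (hlam : 1 < ‖lam‖) {u e : ℝ → ℂ} (hu : ContDiffOn ℝ ∞ u (Ioi 0)) (hu0 : u 0 = 0)
    (he : ContDiffOn ℝ ∞ e (Ici 0)) (he0 : e 0 = 0)
    (h : ∀ x, 0 < x → lam * u x = u (realMap φ x) + e x) : ContDiffOn ℝ ∞ u (Ici 0) := by
  have h1 : ∀ x, 0 < x → lam * u x = (fun _ => (1 : ℂ)) x * u (realMap φ x) + e x :=
    fun x hx => by rw [one_mul, h x hx]
  have hm0 : ‖(fun _ : ℝ => (1 : ℂ)) 0‖ < ‖lam‖ := by simpa using hlam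
  obtain ⟨c, hc, hc0⟩ := exists_tendsto_of_functional_equation hφ hu.continuousOn
    (continuousOn_const (c := (1 : ℂ))) he.continuousOn hm0 h1
  have hne : lam - 1 ≠ 0 := by
    intro h0
    rw [sub_eq_zero.mp h0, norm_one] at hlam
    exact lt_irrefl _ hlam
  have hc1 : c = u 0 := by
    rw [he0] at hc0
    rw [(mul_eq_zero.mp hc0).resolve_left hne, hu0]
  refine contDiffOn_infty.mpr fun k => ?_
  have := contDiffOn_Ici_of_functional_equation hφ ht k hu contDiffOn_const
    (he.of_le (by exact_mod_cast le_top)) hm0 h1 hc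
  rwa [hc1, Function.update_eq_self] at this

theorem extendZero_zero (f : Ioi (0 : ℝ) → ℂ) : extendZero f 0 = 0 := by simp [extendZero]

theorem extendZero_realMap (f : Ioi (0 : ℝ) → ℂ) (η : halfLineDiff) {x : ℝ} (hx : 0 < x) :
    extendZero f (realMap η x) = f (onPos η ⟨x, hx⟩) := by
  rw [extendZero_of_pos f (realMap_pos η hx)]
  congr 1
  exact Subtype.ext (coe_onPos η ⟨x, hx⟩).symm

/-- The system is triangular: `β.2` solves a homogeneous equation, and once it is smooth at `0` its
negative is an admissible inhomogeneous term for `β.1`. -/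
theorem contDiffOn_extendZero_of_mem_solutionSpace {φ : halfLineDiff}
    (hφ : ∀ x : ℝ≥0, 0 < x → x < φ.1 x) (ht : InfinitelyTangentToId φ) {lam : ℂ}
    (hlam : 1 < ‖lam‖) {β : (Ioi (0 : ℝ) → ℂ) × (Ioi (0 : ℝ) → ℂ)}
    (hβ : β ∈ solutionSpace φ lam) :
    ContDiffOn ℝ ∞ (extendZero β.1) (Ici 0) ∧ ContDiffOn ℝ ∞ (extendZero β.2) (Ici 0) := by
  obtain ⟨h1, h2, h3, h4⟩ := hβ
  have hs2 : ContDiffOn ℝ ∞ (extendZero β.2) (Ici 0) :=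
    contDiffOn_Ici_of_eq_comp_add hφ ht hlam (e := fun _ => 0) h2 (extendZero_zero _)
      contDiffOn_const rfl fun x hx => by
        rw [extendZero_realMap _ _ hx, h4, extendZero_of_pos _ hx, add_zero]
  refine ⟨?_, hs2⟩
  refine contDiffOn_Ici_of_eq_comp_add hφ ht hlam (e := fun x => - extendZero β.2 x) h1
    (extendZero_zero _) hs2.neg (by simp [extendZero_zero]) fun x hx => ?_
  rw [extendZero_realMap _ _ hx, h3, extendZero_of_pos _ hx, extendZero_of_pos _ hx]
  ring

end LCReeb

/-! ### Infinite dimensionality of the solution space -/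

namespace LCReeb

open Filter Topology Set

theorem realMap_mul (η θ : halfLineDiff) (t : ℝ) :
    realMap (η * θ) t = realMap η (realMap θ t) := by
  simp [realMap]

/-- The solution of `β ∘ φ = λ β` spread out from a function supported in the fundamental
domain `(1, φ 1)`. -/
noncomputable def spread (φ : halfLineDiff) (lam : ℂ) (h : ℝ → ℂ) (x : ℝ) : ℂ :=
  ∑ᶠ n : ℤ, lam ^ (-n) * h (realMap (φ ^ n) x)

theorem realMap_zpow_natCast (φ : halfLineDiff) (k : ℕ) (x : ℝ≥0) :
    realMap (φ ^ (k : ℤ)) x = φ.1^[k] x := by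
  rw [realMap_coe, zpow_natCast, Equiv.Perm.iterate_eq_pow, Subgroup.coe_pow]

theorem realMap_zpow_neg_natCast (φ : halfLineDiff) (k : ℕ) (x : ℝ≥0) :
    realMap (φ ^ (-(k : ℤ))) x = φ.1.symm^[k] x := by
  have h : φ ^ (-(k : ℤ)) = φ⁻¹ ^ (k : ℤ) := by rw [zpow_neg, inv_zpow]
  rw [h, realMap_zpow_natCast]
  rfl

section Expanding

variable {φ : halfLineDiff} (hφ : ∀ x : ℝ≥0, 0 < x → x < φ.1 x)
include hφ

/-- Local finiteness of the sum defining `spread`. Iterates are monotone in the starting point, so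
the two endpoints `φ⁻¹ x₀` and `φ x₀` control all the orbits in between: forward they pass `φ 1`,
backward they fall below `1`. -/
theorem exists_bound_of_zpow_mem {x₀ : ℝ≥0} (hx₀ : 0 < x₀) :
    ∃ N : ℕ, ∀ x : ℝ≥0, φ.1.symm x₀ < x → x < φ.1 x₀ → ∀ n : ℤ,
      realMap (φ ^ n) x ∈ Ioo 1 (realMap φ 1) → n ∈ Finset.Icc (-(N : ℤ)) N := by
  have h1 : realMap φ 1 = φ.1 1 := by simpa using realMap_coe φ 1
  obtain ⟨N₁, hN₁⟩ := exists_lt_iterate hφ (x := φ.1.symm x₀) ((pos_iff φ⁻¹ x₀).mpr hx₀) (φ.1 1)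
  obtain ⟨N₂, hN₂⟩ := eventually_atTop.mp
    ((tendsto_iterate_inv hφ (φ.1 x₀)).eventually_lt_const one_pos)
  refine ⟨max N₁ N₂, fun x hx1 hx2 n hn => ?_⟩
  rw [Finset.mem_Icc]
  by_contra hcon
  rcases le_total 0 n with h0 | h0
  · lift n to ℕ using h0
    have h2 : N₁ ≤ n := by
      by_contra h3
      exact hcon ⟨by omega, by push_cast; omega⟩
    rw [realMap_zpow_natCast, h1] at hn
    have h3 := (hN₁ n h2).trans_le ((strictMono_of_mem φ).monotone.iterate n hx1.le)
    exact absurd (NNReal.coe_lt_coe.mp hn.2) (not_lt.mpr h3.le)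
  · obtain ⟨k, rfl⟩ := Int.exists_eq_neg_ofNat h0
    have h2 : N₂ ≤ k := by
      by_contra h3
      exact hcon ⟨by push_cast; omega, by omega⟩
    rw [realMap_zpow_neg_natCast] at hn
    have h3 := ((strictMono_of_mem φ⁻¹).monotone.iterate k hx2.le).trans_lt (hN₂ k h2)
    have h4 : (1 : ℝ≥0) < φ.1.symm^[k] x := by exact_mod_cast hn.1
    exact lt_asymm h3 h4

variable {h : ℝ → ℂ} (hs : Function.support h ⊆ Ioo 1 (realMap φ 1)) (lam : ℂ)
include hs

theorem exists_eventually_support_subset {x₀ : ℝ} (hx₀ : 0 < x₀) :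
    ∃ s : Finset ℤ, ∀ᶠ x in 𝓝 x₀, (Function.support fun n : ℤ =>
      lam ^ (-n) * h (realMap (φ ^ n) x)) ⊆ s := by
  lift x₀ to ℝ≥0 using hx₀.le
  obtain ⟨N, hN⟩ := exists_bound_of_zpow_mem hφ (x₀ := x₀) hx₀
  refine ⟨Finset.Icc (-(N : ℤ)) N, ?_⟩
  have h1 : (φ.1.symm x₀ : ℝ) < x₀ := inv_lt_self_of_pos hφ hx₀
  have h2 : (x₀ : ℝ) < φ.1 x₀ := hφ x₀ hx₀
  filter_upwards [Ioo_mem_nhds h1 h2] with x hx n hn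
  have hx0 : 0 ≤ x := (NNReal.coe_nonneg _).trans hx.1.le
  lift x to ℝ≥0 using hx0
  exact hN x hx.1 hx.2 n (hs (right_ne_zero_of_mul hn))

theorem hasFiniteSupport_spread {x : ℝ} (hx : 0 < x) :
    Function.HasFiniteSupport fun n : ℤ => lam ^ (-n) * h (realMap (φ ^ n) x) := by
  obtain ⟨s, h1⟩ := exists_eventually_support_subset hφ hs lam hx
  exact s.finite_toSet.subset h1.self_of_nhds

theorem contDiffOn_spread (hh : ContDiff ℝ ∞ h) :
    ContDiffOn ℝ ∞ (spread φ lam h) (Ioi 0) := by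
  intro x₀ hx₀
  obtain ⟨s, h1⟩ := exists_eventually_support_subset hφ hs lam hx₀
  have h2 : spread φ lam h =ᶠ[𝓝 x₀] fun x => ∑ n ∈ s, lam ^ (-n) * h (realMap (φ ^ n) x) := by
    filter_upwards [h1] with x hx using finsum_eq_sum_of_support_subset _ hx
  have h3 : ContDiffAt ℝ ∞ (fun x => ∑ n ∈ s, lam ^ (-n) * h (realMap (φ ^ n) x)) x₀ := by
    refine ContDiffAt.sum fun n _ => contDiffAt_const.mul (hh.contDiffAt.comp x₀ ?_)
    exact (contDiffOn_realMap (φ ^ n)).contDiffAt (Ici_mem_nhds hx₀)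
  exact (h3.congr_of_eventuallyEq h2).contDiffWithinAt

omit hφ hs in
theorem spread_realMap (hlam : lam ≠ 0) (x : ℝ) :
    spread φ lam h (realMap φ x) = lam * spread φ lam h x := by
  rw [spread, spread, mul_finsum, ← finsum_comp_equiv (Equiv.addRight (1 : ℤ))
    (f := fun n => lam * (lam ^ (-n) * h (realMap (φ ^ n) x)))]
  refine finsum_congr fun n => ?_
  rw [Equiv.coe_addRight, zpow_add φ, zpow_one, realMap_mul, neg_add, zpow_add₀ hlam]
  field_simp

/-- The interval `(1, φ 1)` is disjoint from its translates under nonzero powers of `φ`, so only the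
term `n = 0` survives. -/
theorem spread_eq_of_mem {x : ℝ} (hx : x ∈ Ioo 1 (realMap φ 1)) :
    spread φ lam h x = h x := by
  have hx0 : 0 ≤ x := zero_le_one.trans hx.1.le
  lift x to ℝ≥0 using hx0
  have h1 : realMap φ 1 = φ.1 1 := by simpa using realMap_coe φ 1
  have hle : id ≤ (φ.1 : ℝ≥0 → ℝ≥0) := fun x => by
    rcases eq_or_ne x 0 with rfl | hx
    · exact zero_le
    · exact (hφ x (pos_iff_ne_zero.mpr hx)).le
  rw [spread, finsum_eq_single _ 0]
  · rw [neg_zero, zpow_zero, one_mul, zpow_zero, realMap_coe]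
    rfl
  · intro n hn
    by_contra hne
    have hm := hs (right_ne_zero_of_mul hne)
    rcases le_total 0 n with h0 | h0
    · lift n to ℕ using h0
      obtain ⟨k, rfl⟩ := Nat.exists_eq_succ_of_ne_zero (by exact_mod_cast hn : n ≠ 0)
      rw [realMap_zpow_natCast, h1, Function.iterate_succ_apply] at hm
      have h2 : φ.1 1 < φ.1 x := strictMono_of_mem φ (by exact_mod_cast hx.1)
      exact lt_asymm (NNReal.coe_lt_coe.mp hm.2)
        (h2.trans_le (Function.id_le_iterate_of_id_le hle k _))
    · obtain ⟨k, rfl⟩ := Int.exists_eq_neg_ofNat h0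
      obtain ⟨k, rfl⟩ := Nat.exists_eq_succ_of_ne_zero (by rintro rfl; simp at hn : k ≠ 0)
      rw [realMap_zpow_neg_natCast, Function.iterate_succ_apply] at hm
      have hx2 : x < φ.1 1 := by
        have := hx.2
        rw [h1] at this
        exact this
      have h2 : φ.1.symm x < 1 := by
        have := strictMono_of_mem φ⁻¹ hx2
        exact this.trans_eq (φ.1.symm_apply_apply 1)
      have h3 : φ.1.symm^[k] (φ.1.symm x) ≤ φ.1.symm x :=
        Function.iterate_le_id_of_le_id (fun y => inv_le_self hφ y) k _
      have h4 : (1 : ℝ≥0) < φ.1.symm^[k] (φ.1.symm x) := by exact_mod_cast hm.1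
      exact lt_asymm (h3.trans_lt h2) h4

end Expanding

/-- The space of solutions is infinite dimensional: it contains the spreads of all products of a
fixed bump function with a polynomial. -/
theorem not_finiteDimensional_solutionSpace {φ : halfLineDiff}
    (hφ : ∀ x : ℝ≥0, 0 < x → x < φ.1 x) {lam : ℂ} (hlam : lam ≠ 0) :
    ¬ FiniteDimensional ℂ (solutionSpace φ lam) := by
  intro hfin
  set b := realMap φ 1 with hb
  have hb1 : 1 < b := by
    have h1 : realMap φ 1 = φ.1 1 := by simpa using realMap_coe φ 1
    rw [hb, h1]
    exact_mod_cast hφ 1 one_pos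
  -- The outer radius is half of the distance `(b - 1) / 2` from the centre to the ends of `(1, b)`,
  -- which keeps the support inside.
  let ψ : ContDiffBump ((1 + b) / 2) :=
    ⟨(b - 1) / 8, (b - 1) / 4, by linarith, by linarith⟩
  let h : Polynomial ℂ → ℝ → ℂ := fun P t => (ψ t : ℂ) * P.eval (t : ℂ)
  have hh : ∀ P, ContDiff ℝ ∞ (h P) := fun P => by
    refine (Complex.ofRealCLM.contDiff.comp ψ.contDiff).mul ?_
    have : ContDiff ℂ ∞ fun z : ℂ => P.eval z := by
      simpa using P.contDiff_aeval (𝕜 := ℂ) ∞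
    exact (this.restrict_scalars ℝ).comp Complex.ofRealCLM.contDiff
  have hs : ∀ P, Function.support (h P) ⊆ Ioo 1 b := fun P t ht => by
    have h1 : t ∈ Function.support ψ := by
      intro h0
      exact ht (by simp [h, h0])
    rw [ψ.support_eq, Real.ball_eq_Ioo] at h1
    have h2 : ψ.rOut = (b - 1) / 4 := rfl
    rw [h2] at h1
    constructor <;> linarith [h1.1, h1.2]
  let β : Polynomial ℂ → Ioi (0 : ℝ) → ℂ := fun P x => spread φ lam (h P) x
  have hβ : ∀ P, ((β P, 0) : (Ioi (0 : ℝ) → ℂ) × (Ioi (0 : ℝ) → ℂ)) ∈ solutionSpace φ lam := by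
    intro P
    refine ⟨?_, (solutionSpace φ lam).zero_mem.2.1, fun x => ?_, fun x => by simp⟩
    · refine (contDiffOn_spread hφ (hs P) lam (hh P)).congr fun t ht => ?_
      rw [extendZero_of_pos _ ht]
    · simp only [β, Pi.zero_apply, add_zero, coe_onPos, spread_realMap lam hlam]
  let Φ : Polynomial ℂ →ₗ[ℂ] solutionSpace φ lam :=
    { toFun := fun P => ⟨(β P, 0), hβ P⟩
      map_add' := fun P Q => by
        refine Subtype.ext (Prod.ext (funext fun x => ?_) (by simp))
        change spread φ lam (h (P + Q)) x = spread φ lam (h P) x + spread φ lam (h Q) x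
        rw [spread, spread, spread,
          ← finsum_add_distrib (hasFiniteSupport_spread hφ (hs P) lam x.2)
            (hasFiniteSupport_spread hφ (hs Q) lam x.2)]
        refine finsum_congr fun n => ?_
        simp only [h, Polynomial.eval_add]
        ring
      map_smul' := fun c P => by
        refine Subtype.ext (Prod.ext (funext fun x => ?_) (by simp))
        change spread φ lam (h (c • P)) x = c * spread φ lam (h P) x
        rw [spread, spread, mul_finsum]
        refine finsum_congr fun n => ?_
        simp only [h, Polynomial.eval_smul, smul_eq_mul]
        ring }
  refine Polynomial.not_finite (R := ℂ) (Module.Finite.of_injective Φ ?_)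
  refine (injective_iff_map_eq_zero Φ).mpr fun P hP => ?_
  -- On the interval where the bump equals `1`, the spread of `h P` is `P` itself; if the spread
  -- vanishes, `P` has infinitely many roots.
  refine Polynomial.eq_zero_of_infinite_isRoot P ?_
  have hinf : (Ioo ((1 + b) / 2) ((1 + b) / 2 + (b - 1) / 8)).Infinite :=
    Ioo_infinite (by linarith)
  refine (hinf.image Complex.ofReal_injective.injOn).mono ?_
  rintro _ ⟨t, ht, rfl⟩
  have ht1 : t ∈ Ioo 1 b := ⟨by linarith [ht.1], by linarith [ht.2]⟩
  have h1 : spread φ lam (h P) t = 0 :=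
    congrFun (congrArg (fun q => q.1.1) hP) ⟨t, zero_lt_one.trans ht1.1⟩
  rw [spread_eq_of_mem hφ (hs P) lam ht1] at h1
  have h2 : ψ t = 1 := by
    refine ψ.one_of_mem_closedBall ?_
    rw [Real.closedBall_eq_Icc]
    have h2 : ψ.rIn = (b - 1) / 8 := rfl
    rw [h2]
    constructor <;> linarith [ht.1, ht.2]
  simpa [h, h2] using h1

end LCReeb

/-! ### The covering of the Reeb component and lifts of its self-maps -/

namespace LCReeb

open Filter Topology Set

/-! The topology of the covering space. -/

/-- The removed point lies on the face `x = 0`, which a segment issuing from an interior point can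
meet only at its other end. This makes the cover contractible, as needed for lifting maps. -/
theorem starConvex_coverSet : StarConvex ℝ (((0, 0), 1) : (ℂ × ℂ) × ℝ) coverSet := by
  rintro y ⟨hy0, hy⟩ a b ha hb hab
  have h2 : (a • (((0, 0), 1) : (ℂ × ℂ) × ℝ) + b • y).2 = a + b * y.2 := by simp
  refine ⟨?_, fun h => ?_⟩
  · rw [h2]; positivity
  · have h3 : a + b * y.2 = 0 := by rw [← h2, h]; rfl
    have h4 : a = 0 := by nlinarith [mul_nonneg hb hy0]
    have h5 : b = 1 := by linarith
    rw [h4, h5] at h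
    exact hy (by simpa using h)

theorem base_mem_coverSet (x : ℝ) (hx : 0 ≤ x) : (((1, 0), x) : (ℂ × ℂ) × ℝ) ∈ coverSet :=
  ⟨hx, fun h => one_ne_zero (congrArg (fun q => q.1.1) h)⟩

instance : ContractibleSpace Cover :=
  starConvex_coverSet.contractibleSpace ⟨_, base_mem_coverSet 0 le_rfl⟩

instance : LocallyPathConnectedSpace Cover := by
  have hC : Convex ℝ {q : (ℂ × ℂ) × ℝ | 0 ≤ q.2} :=
    (convex_Ici (0 : ℝ)).linear_preimage (LinearMap.snd ℝ (ℂ × ℂ) ℝ)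
  have := hC.locallyPathConnectedSpace
  have hsub : coverSet ⊆ {q : (ℂ × ℂ) × ℝ | 0 ≤ q.2} := fun q hq => hq.1
  have ho : IsOpen {q : {q : (ℂ × ℂ) × ℝ | 0 ≤ q.2} | q.1 ≠ 0} :=
    isOpen_ne_fun continuous_subtype_val continuous_const
  have he : IsOpenEmbedding (inclusion hsub) := by
    refine .inclusion hsub ?_
    convert ho using 1
    ext q
    exact ⟨fun h => h.2, fun h => ⟨q.2, h⟩⟩
  exact he.locallyPathConnectedSpace

/-- The base point of the covering space, on the boundary leaf. -/
def basePoint : Cover := ⟨((1, 0), 0), base_mem_coverSet 0 le_rfl⟩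

theorem isPreconnected_height_eq_zero : IsPreconnected {q : Cover | height q = 0} := by
  have hr : 1 < Module.rank ℝ (ℂ × ℂ) := by
    rw [← Module.finrank_eq_rank, Module.finrank_prod, Complex.finrank_real_complex]
    norm_num
  have h1 : IsPreconnected ({0}ᶜ : Set (ℂ × ℂ)) :=
    (isConnected_compl_singleton_of_one_lt_rank hr 0).isPreconnected
  let j : ({0}ᶜ : Set (ℂ × ℂ)) → Cover := fun z =>
    ⟨(z.1, 0), le_rfl, fun h => z.2 (congrArg Prod.fst h)⟩
  have hj : Continuous j := by
    refine Continuous.subtype_mk ?_ _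
    fun_prop
  have h2 : range j = {q : Cover | height q = 0} := by
    ext q
    constructor
    · rintro ⟨z, rfl⟩
      rfl
    · intro hq
      have hq2 : q.1.2 = 0 := congrArg NNReal.toReal hq
      exact ⟨⟨q.1.1, fun h => q.2.2 (Prod.ext h hq2)⟩, Subtype.ext (Prod.ext rfl hq2.symm)⟩
  rw [← h2]
  have := isPreconnected_iff_preconnectedSpace.mp h1
  exact isPreconnected_range hj

theorem continuous_height : Continuous height := by
  unfold height
  fun_prop

/-! The linear part of the Hopf construction. -/

/-- The Jordan block with eigenvalue `lam`. -/
def jordan (lam : ℂ) (z : ℂ × ℂ) : ℂ × ℂ := (lam * z.1 + z.2, lam * z.2)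

/-- The inverse of the Jordan block with eigenvalue `lam`. -/
noncomputable def jordanInv (lam : ℂ) (z : ℂ × ℂ) : ℂ × ℂ :=
  ((z.1 - z.2 / lam) / lam, z.2 / lam)

/-- A norm on `ℂ × ℂ` in which the Jordan block is almost a homothety. -/
noncomputable def weightedNorm (K : ℝ) (z : ℂ × ℂ) : ℝ := ‖z.1‖ + K * ‖z.2‖

/-- The off-diagonal entry of the Jordan block contributes at most `‖z.2‖ = ε * (K * ‖z.2‖)`, which
is at most `ε` times the weighted norm. -/
theorem weightedNorm_jordan_le {K ε : ℝ} (hK : 0 < K) (hKε : ε * K = 1) (lam : ℂ) (z : ℂ × ℂ) :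
    weightedNorm K (jordan lam z) ≤ (‖lam‖ + ε) * weightedNorm K z := by
  have h1 : ‖lam * z.1 + z.2‖ ≤ ‖lam‖ * ‖z.1‖ + ‖z.2‖ := by
    rw [← norm_mul]; exact norm_add_le _ _
  have hε : 0 < ε := pos_of_mul_pos_left (hKε ▸ one_pos) hK.le
  have e1 : 0 ≤ ε * ‖z.1‖ := by positivity
  have e2 : ε * K * ‖z.2‖ = ‖z.2‖ := by rw [hKε, one_mul]
  simp only [weightedNorm, jordan, norm_mul lam z.2]
  nlinarith

theorem le_weightedNorm_jordan {K ε : ℝ} (hK : 0 < K) (hKε : ε * K = 1) (lam : ℂ) (z : ℂ × ℂ) :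
    (‖lam‖ - ε) * weightedNorm K z ≤ weightedNorm K (jordan lam z) := by
  have h1 : ‖lam‖ * ‖z.1‖ ≤ ‖lam * z.1 + z.2‖ + ‖z.2‖ := by
    rw [← norm_mul]
    calc ‖lam * z.1‖ = ‖(lam * z.1 + z.2) - z.2‖ := by ring_nf
      _ ≤ _ := norm_sub_le _ _
  have hε : 0 < ε := pos_of_mul_pos_left (hKε ▸ one_pos) hK.le
  have e1 : 0 ≤ ε * ‖z.1‖ := by positivity
  have e2 : ε * K * ‖z.2‖ = ‖z.2‖ := by rw [hKε, one_mul]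
  simp only [weightedNorm, jordan, norm_mul lam z.2]
  nlinarith

theorem weightedNorm_nonneg {K : ℝ} (hK : 0 < K) (z : ℂ × ℂ) : 0 ≤ weightedNorm K z := by
  unfold weightedNorm
  positivity

theorem weightedNorm_pos {K : ℝ} (hK : 0 < K) {z : ℂ × ℂ} (hz : z ≠ 0) : 0 < weightedNorm K z := by
  by_cases h1 : z.1 = 0
  · have h2 : z.2 ≠ 0 := fun h2 => hz (Prod.ext h1 h2)
    have := norm_pos_iff.mpr h2
    unfold weightedNorm
    positivity
  · have := norm_pos_iff.mpr h1
    unfold weightedNorm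
    positivity

theorem continuous_weightedNorm (K : ℝ) : Continuous (weightedNorm K) := by
  unfold weightedNorm
  fun_prop

namespace HopfData

variable {D : HopfData}

instance : TopologicalSpace D.Reeb :=
  inferInstanceAs (TopologicalSpace (MulAction.orbitRel.Quotient (Subgroup.zpowers D.T) Cover))

theorem one_lt_norm_lam : 1 < ‖D.lam‖ := D.one_lt_mu.trans_le D.mu_le_lam

/-- The resonance relation reads `λ = λ^p`, and powers of `‖λ‖ > 1` are distinct. -/
theorem p_eq_one (htau : D.tau = 1) (hlam : D.lam = D.mu) : D.p = 1 := by
  have h1 := D.resonance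
  rw [htau, mul_one, sub_eq_zero, ← hlam] at h1
  have h2 : ‖D.lam‖ ^ 1 = ‖D.lam‖ ^ D.p := by
    rw [pow_one, ← norm_pow, ← h1]
  exact (pow_right_injective₀ (zero_lt_one.trans one_lt_norm_lam) one_lt_norm_lam.ne' h2).symm

theorem T_apply (htau : D.tau = 1) (hlam : D.lam = D.mu) (q : Cover) :
    (D.T q).1 = (jordan D.lam q.1.1, realMap D.φ q.1.2) := by
  have h : realMap D.φ q.1.2 = D.φ.1 (height q) := realMap_coe D.φ (height q)
  rw [h]
  change ((D.lam * q.1.1.1 + D.tau * q.1.1.2 ^ D.p, D.mu * q.1.1.2), (D.φ.1 (height q) : ℝ)) = _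
  rw [htau, p_eq_one htau hlam, jordan, ← hlam, one_mul, pow_one]

theorem T_symm_apply (htau : D.tau = 1) (hlam : D.lam = D.mu) (q : Cover) :
    (D.T.symm q).1 = (jordanInv D.lam q.1.1, realMap D.φ⁻¹ q.1.2) := by
  have h : realMap D.φ⁻¹ q.1.2 = D.φ.1.symm (height q) := realMap_coe D.φ⁻¹ (height q)
  rw [h]
  change (((q.1.1.1 - D.tau * (q.1.1.2 / D.mu) ^ D.p) / D.lam, q.1.1.2 / D.mu),
      (D.φ.1.symm (height q) : ℝ)) = _
  rw [htau, p_eq_one htau hlam, jordanInv, ← hlam, one_mul, pow_one]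

theorem height_T (q : Cover) : height (D.T q) = D.φ.1 (height q) := rfl

theorem continuous_T (htau : D.tau = 1) (hlam : D.lam = D.mu) : Continuous D.T := by
  rw [continuous_induced_rng]
  have : (Subtype.val ∘ D.T : Cover → _) =
      fun q => (jordan D.lam q.1.1, realMap D.φ q.1.2) := funext (T_apply htau hlam)
  rw [this]
  have := continuous_realMap D.φ
  unfold jordan
  fun_prop

theorem continuous_T_symm (htau : D.tau = 1) (hlam : D.lam = D.mu) : Continuous D.T.symm := by
  rw [continuous_induced_rng]
  have : (Subtype.val ∘ D.T.symm : Cover → _) =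
      fun q => (jordanInv D.lam q.1.1, realMap D.φ⁻¹ q.1.2) := funext (T_symm_apply htau hlam)
  rw [this]
  have := continuous_realMap D.φ⁻¹
  unfold jordanInv
  simp only [div_eq_mul_inv]
  fun_prop

theorem continuous_T_zpow (htau : D.tau = 1) (hlam : D.lam = D.mu) (n : ℤ) :
    Continuous (D.T ^ n : Equiv.Perm Cover) := by
  induction n using Int.induction_on with
  | zero => exact continuous_id
  | succ n ih =>
    rw [zpow_add_one]
    exact ih.comp (continuous_T htau hlam)
  | pred n ih =>
    rw [zpow_sub_one]
    exact ih.comp (continuous_T_symm htau hlam)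

theorem proj_eq_iff_mem_orbit {q q' : Cover} :
    D.proj q = D.proj q' ↔ q ∈ MulAction.orbit (Subgroup.zpowers D.T) q' :=
  Quotient.eq (r := MulAction.orbitRel (Subgroup.zpowers D.T) Cover)

theorem proj_eq_iff {q q' : Cover} :
    D.proj q = D.proj q' ↔ ∃ n : ℤ, (D.T ^ n : Equiv.Perm Cover) q' = q := by
  rw [proj_eq_iff_mem_orbit, MulAction.mem_orbit_iff]
  constructor
  · rintro ⟨⟨_, n, rfl⟩, h⟩
    exact ⟨n, h⟩
  · rintro ⟨n, h⟩
    exact ⟨⟨_, n, rfl⟩, h⟩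

theorem proj_T (q : Cover) : D.proj (D.T q) = D.proj q :=
  proj_eq_iff.mpr ⟨1, by rw [zpow_one]⟩

/-- A neighbourhood which is disjoint from its translates, constructed from a continuous
function which increases along the orbits of `T`. -/
theorem exists_disjoint_nhds_of_increasing {ν : Cover → ℝ} (hν : Continuous ν) {a b : ℝ}
    (hle : ∀ q, ν q ≤ ν (D.T q)) (hab : ∀ q, a < ν q → b ≤ ν (D.T q)) {q : Cover}
    (ha : a < ν q) (hb : ν q < b) :
    ∃ U ∈ 𝓝 q, ∀ g : Subgroup.zpowers D.T, ((g • ·) '' U ∩ U).Nonempty → g = 1 := by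
  -- One application of `T` already jumps over the window `(a, b)`, and `ν` never decreases
  -- afterwards, so no orbit visits the window twice.
  have key : ∀ n : ℕ, ∀ y, a < ν y → b ≤ ν ((D.T ^ (n + 1) : Equiv.Perm Cover) y) := by
    intro n
    induction n with
    | zero => intro y hy; simpa using hab y hy
    | succ n ih =>
      intro y hy
      rw [pow_succ']
      exact (ih y hy).trans (hle _)
  have hno : ∀ n : ℕ, ∀ y, ν y ∈ Ioo a b → ν ((D.T ^ (n + 1) : Equiv.Perm Cover) y) ∉ Ioo a b :=
    fun n y hy h => absurd h.2 (not_lt.mpr (key n y hy.1))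
  refine ⟨ν ⁻¹' Ioo a b, hν.continuousAt (Ioo_mem_nhds ha hb), ?_⟩
  rintro ⟨g, hg⟩ ⟨_, ⟨y, hy, rfl⟩, hgy⟩
  obtain ⟨n, rfl⟩ := hg
  have hgy' : ν ((D.T ^ n : Equiv.Perm Cover) y) ∈ Ioo a b := hgy
  have hn0 : n = 0 := by
    rcases lt_trichotomy n 0 with h | h | h
    · obtain ⟨k, rfl⟩ : ∃ k : ℕ, n = -((k : ℤ) + 1) := ⟨(-n - 1).toNat, by omega⟩
      refine absurd hy ?_
      have h1 : ν ((D.T ^ (k + 1) : Equiv.Perm Cover)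
          ((D.T ^ (-((k : ℤ) + 1)) : Equiv.Perm Cover) y)) ∉ Ioo a b := hno k _ hgy'
      have h2 : (D.T ^ (k + 1) : Equiv.Perm Cover)
          ((D.T ^ (-((k : ℤ) + 1)) : Equiv.Perm Cover) y) = y := by
        rw [← Equiv.Perm.mul_apply, ← zpow_natCast, ← zpow_add]
        simp
      rwa [h2] at h1
    · exact h
    · obtain ⟨k, rfl⟩ : ∃ k : ℕ, n = (k : ℤ) + 1 := ⟨(n - 1).toNat, by omega⟩
      exact absurd hgy' (hno k y hy)
  subst hn0
  rfl

/-- Off the boundary the height increases along orbits and separates translates. On the boundary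
leaf the height is constant, and a weighted norm expanded by the Jordan block takes its place. -/
theorem isQuotientCoveringMap_proj (htau : D.tau = 1) (hlam : D.lam = D.mu) :
    IsQuotientCoveringMap D.proj (Subgroup.zpowers D.T) where
  toIsQuotientMap := isQuotientMap_quotient_mk'
  continuous_const_smul := by
    rintro ⟨_, n, rfl⟩
    exact continuous_T_zpow htau hlam n
  apply_eq_iff_mem_orbit := proj_eq_iff_mem_orbit
  disjoint q := by
    by_cases hq : 0 < q.1.2
    · have h1 : D.φ.1.symm (height q) < height q := inv_lt_self_of_pos D.expanding hq
      -- With `φ⁻¹ x < a < x`, the window `(a, φ a)` contains the height `x` of `q`.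
      obtain ⟨a, ha1, ha2⟩ := exists_between h1
      refine exists_disjoint_nhds_of_increasing (ν := fun q => (height q : ℝ)) (a := a)
        (b := D.φ.1 a) (NNReal.continuous_coe.comp continuous_height) ?_ ?_ ?_ ?_
      · intro q
        rw [height_T, NNReal.coe_le_coe]
        rcases eq_or_ne (height q) 0 with h | h
        · rw [h]; exact zero_le
        · exact (D.expanding _ (pos_iff_ne_zero.mpr h)).le
      · intro q hq
        rw [height_T, NNReal.coe_le_coe]
        exact (strictMono_of_mem D.φ).monotone (le_of_lt (NNReal.coe_lt_coe.mp hq))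
      · exact NNReal.coe_lt_coe.mpr ha2
      · refine NNReal.coe_lt_coe.mpr ?_
        have := strictMono_of_mem D.φ ha1
        rwa [Equiv.apply_symm_apply] at this
    · have hlam1 : 1 < ‖D.lam‖ := one_lt_norm_lam
      -- Half of the gap, so that the expansion factor `κ = ‖λ‖ - ε` still exceeds `1`.
      set ε : ℝ := (‖D.lam‖ - 1) / 2 with hε
      have hε0 : 0 < ε := by linarith
      have hK : 0 < ε⁻¹ := inv_pos.mpr hε0
      set κ : ℝ := ‖D.lam‖ - ε with hκe
      have hκ : 1 < κ := by linarith
      set ν : Cover → ℝ := fun q => weightedNorm ε⁻¹ q.1.1 with hν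
      have hT : ∀ q, κ * ν q ≤ ν (D.T q) := fun q => by
        simp only [hν, T_apply htau hlam]
        exact le_weightedNorm_jordan hK (mul_inv_cancel₀ hε0.ne') D.lam q.1.1
      have hν0 : ∀ q, 0 ≤ ν q := fun q => weightedNorm_nonneg hK _
      have hpos : 0 < ν q := weightedNorm_pos hK fun h =>
        q.2.2 (Prod.ext h (le_antisymm (not_lt.mp hq) q.2.1))
      obtain ⟨a, ha1, ha2⟩ := exists_between (div_lt_self hpos hκ)
      rw [div_lt_iff₀ (by linarith)] at ha1
      refine exists_disjoint_nhds_of_increasing (ν := ν) (a := a) (b := a * κ) ?_ ?_ ?_ ha2 ha1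
      · exact (continuous_weightedNorm _).comp (by fun_prop)
      · intro q
        exact le_trans (by nlinarith [hν0 q]) (hT q)
      · intro q hq
        refine le_trans ?_ (hT q)
        nlinarith

theorem isCoveringMap_proj (htau : D.tau = 1) (hlam : D.lam = D.mu) : IsCoveringMap D.proj :=
  (isQuotientCoveringMap_proj htau hlam).isCoveringMap

theorem IsLeafwiseHolomorphic.continuous {f : D.Reeb → D.Reeb} (hf : IsLeafwiseHolomorphic f) :
    Continuous f := by
  have hp : IsQuotientMap D.proj := isQuotientMap_quotient_mk'
  rw [hp.continuous_iff, continuous_iff_continuousAt]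
  intro q₀
  obtain ⟨U, G, hU, hq₀, hG, hGs, -, -⟩ := hf q₀
  have ho : IsOpen {q : Cover | q.1 ∈ U} := hU.preimage continuous_subtype_val
  refine ContinuousOn.continuousAt (s := {q : Cover | q.1 ∈ U}) ?_ (ho.mem_nhds hq₀)
  rw [continuousOn_iff_continuous_domRestrict]
  have h1 : Continuous fun q : {q : Cover | q.1 ∈ U} => (⟨G q.1.1, (hG q.1 q.2).1⟩ : Cover) :=
    Continuous.subtype_mk (hGs.continuousOn.comp_continuous (by fun_prop)
      fun q => ⟨q.2, q.1.2⟩) _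
  convert hp.continuous.comp h1 using 1
  funext q
  exact (hG q.1 q.2).2

/-- A continuous self-map of the cover which lifts `f` and fixes the base point. -/
structure IsLift (f : D.Reeb → D.Reeb) (F : Cover → Cover) : Prop where
  continuous : Continuous F
  base : F basePoint = basePoint
  proj_apply : ∀ q, D.proj (F q) = f (D.proj q)

theorem exists_isLift (htau : D.tau = 1) (hlam : D.lam = D.mu) {f : D.Reeb → D.Reeb}
    (hf : Continuous f) (hb : f (D.proj basePoint) = D.proj basePoint) :
    ∃ F, IsLift f F := by
  have hp : Continuous D.proj := (isCoveringMap_proj htau hlam).continuous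
  obtain ⟨F, ⟨h1, h2⟩, -⟩ := (isCoveringMap_proj htau hlam).existsUnique_continuousMap_lifts
    ⟨f ∘ D.proj, hf.comp hp⟩ basePoint basePoint hb.symm
  exact ⟨F, F.continuous, h1, congrFun h2⟩

theorem IsLift.unique (htau : D.tau = 1) (hlam : D.lam = D.mu) {f : D.Reeb → D.Reeb}
    {F G : Cover → Cover} (hF : IsLift f F) (hG : IsLift f G) : F = G :=
  (isCoveringMap_proj htau hlam).eq_of_comp_eq hF.continuous hG.continuous
    (funext fun q => (hF.proj_apply q).trans (hG.proj_apply q).symm) basePoint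
    (hF.base.trans hG.base.symm)

theorem IsLift.comp {f g : D.Reeb → D.Reeb} {F G : Cover → Cover} (hF : IsLift f F)
    (hG : IsLift g G) : IsLift (f ∘ g) (F ∘ G) where
  continuous := hF.continuous.comp hG.continuous
  base := by rw [Function.comp_apply, hG.base, hF.base]
  proj_apply q := by rw [Function.comp_apply, hF.proj_apply, hG.proj_apply]; rfl

theorem IsLift.id : IsLift (D := D) id id := ⟨continuous_id, rfl, fun _ => rfl⟩

/-- Over the boundary both `F` and the identity lift `proj`; they agree at the base point, and the
boundary leaf of the cover is connected. -/
theorem IsLift.eq_self_of_height_eq_zero (htau : D.tau = 1) (hlam : D.lam = D.mu)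
    {f : D.Reeb → D.Reeb} {F : Cover → Cover} (hF : IsLift f F)
    (hf : ∀ r ∈ D.boundary, f r = r) {q : Cover} (hq : height q = 0) : F q = q :=
  (isCoveringMap_proj htau hlam).eqOn_of_comp_eqOn isPreconnected_height_eq_zero
    hF.continuous.continuousOn continuousOn_id
    (fun q hq => (hF.proj_apply q).trans (hf _ ⟨q, hq, rfl⟩)) (a := basePoint) rfl hF.base hq

/-- Both sides are lifts of `f ∘ proj`. They agree at the base point because its image under `T` is
again on the boundary leaf, where `F` is the identity. -/
theorem IsLift.apply_T (htau : D.tau = 1) (hlam : D.lam = D.mu)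
    {f : D.Reeb → D.Reeb} {F : Cover → Cover} (hF : IsLift f F)
    (hf : ∀ r ∈ D.boundary, f r = r) (q : Cover) : F (D.T q) = D.T (F q) := by
  refine congrFun ((isCoveringMap_proj htau hlam).eq_of_comp_eq
    (hF.continuous.comp (continuous_T htau hlam))
    ((continuous_T htau hlam).comp hF.continuous) (funext fun q => ?_) basePoint ?_) q
  · simp only [Function.comp_apply, hF.proj_apply, proj_T]
  · simp only [Function.comp_apply, hF.base]
    refine hF.eq_self_of_height_eq_zero htau hlam hf ?_
    rw [height_T]
    exact map_zero_of_mem D.φ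

end HopfData

end LCReeb

/-! ### Smoothness and leafwise holomorphy of lifts -/

namespace LCReeb

open Filter Topology Set

/-- A map is smooth, preserves the transverse coordinate and is holomorphic along the leaves on
the part of the cover in `U`. -/
structure LeafwiseHolomorphicOn (G : (ℂ × ℂ) × ℝ → (ℂ × ℂ) × ℝ) (U : Set ((ℂ × ℂ) × ℝ)) :
    Prop where
  contDiffOn : ContDiffOn ℝ ∞ G (U ∩ coverSet)
  height_eq : ∀ q ∈ U ∩ coverSet, ∀ q' ∈ U ∩ coverSet, q.2 = q'.2 → (G q).2 = (G q').2
  differentiableAt : ∀ q ∈ U ∩ coverSet, DifferentiableAt ℂ (fun z : ℂ × ℂ => (G (z, q.2)).1) q.1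

namespace LeafwiseHolomorphicOn

variable {F G : (ℂ × ℂ) × ℝ → (ℂ × ℂ) × ℝ} {U V : Set ((ℂ × ℂ) × ℝ)}

theorem eventually_mem (hU : IsOpen U) {q : (ℂ × ℂ) × ℝ} (hq : q ∈ U ∩ coverSet) :
    ∀ᶠ z in 𝓝 q.1, (z, q.2) ∈ U ∩ coverSet := by
  have hc : Continuous fun z : ℂ × ℂ => (z, q.2) := by fun_prop
  exact (hc.continuousAt.eventually (hU.mem_nhds hq.1)).and (HopfData.eventually_mem_coverSet hq.2)

theorem mono (hG : LeafwiseHolomorphicOn G U) (h : V ⊆ U) : LeafwiseHolomorphicOn G V where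
  contDiffOn := hG.contDiffOn.mono (inter_subset_inter_left _ h)
  height_eq q hq q' hq' := hG.height_eq q ⟨h hq.1, hq.2⟩ q' ⟨h hq'.1, hq'.2⟩
  differentiableAt q hq := hG.differentiableAt q ⟨h hq.1, hq.2⟩

theorem congr (hU : IsOpen U) (hG : LeafwiseHolomorphicOn G U)
    (h : ∀ q ∈ U ∩ coverSet, F q = G q) : LeafwiseHolomorphicOn F U where
  contDiffOn := hG.contDiffOn.congr h
  height_eq q hq q' hq' hqq' := by rw [h q hq, h q' hq', hG.height_eq q hq q' hq' hqq']
  differentiableAt q hq := (hG.differentiableAt q hq).congr_of_eventuallyEq (by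
    filter_upwards [eventually_mem hU hq] with z hz
    rw [h _ hz])

theorem comp (hU : IsOpen U) (hF : LeafwiseHolomorphicOn F V) (hG : LeafwiseHolomorphicOn G U)
    (hm : MapsTo G (U ∩ coverSet) (V ∩ coverSet)) : LeafwiseHolomorphicOn (F ∘ G) U where
  contDiffOn := hF.contDiffOn.comp hG.contDiffOn hm
  height_eq q hq q' hq' h := hF.height_eq _ (hm hq) _ (hm hq') (hG.height_eq q hq q' hq' h)
  differentiableAt q hq := by
    have h3 : DifferentiableAt ℂ (fun z : ℂ × ℂ => (F ((G (z, q.2)).1, (G q).2)).1) q.1 :=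
      DifferentiableAt.comp q.1 (g := fun w : ℂ × ℂ => (F (w, (G q).2)).1)
        (hF.differentiableAt (G q) (hm hq)) (hG.differentiableAt q hq)
    refine h3.congr_of_eventuallyEq ?_
    filter_upwards [eventually_mem hU hq] with z hz
    rw [Function.comp_apply, ← hG.height_eq _ hz _ hq rfl]

theorem prodMap {A : ℂ × ℂ → ℂ × ℂ} (hA : ContDiff ℂ ∞ A) (η : halfLineDiff) :
    LeafwiseHolomorphicOn (fun q => (A q.1, realMap η q.2)) univ where
  contDiffOn := by
    refine ContDiffOn.prodMk ?_ ?_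
    · exact ((hA.restrict_scalars ℝ).comp contDiff_fst).contDiffOn
    · exact (contDiffOn_realMap η).comp contDiff_snd.contDiffOn fun q hq => hq.2.1
  height_eq q _ q' _ h := by simp only [h]
  differentiableAt q _ := hA.differentiable (by simp) q.1

end LeafwiseHolomorphicOn

open Classical in
/-- Extension of a self-map of the cover to the ambient space. -/
noncomputable def rawMap (F : Cover → Cover) (q : (ℂ × ℂ) × ℝ) : (ℂ × ℂ) × ℝ :=
  if h : q ∈ coverSet then (F ⟨q, h⟩).1 else q

theorem rawMap_of_mem (F : Cover → Cover) {q : (ℂ × ℂ) × ℝ} (h : q ∈ coverSet) :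
    rawMap F q = (F ⟨q, h⟩).1 := dif_pos h

theorem rawMap_coe (F : Cover → Cover) (q : Cover) : rawMap F q.1 = (F q).1 :=
  rawMap_of_mem F q.2

theorem rawMap_mem (F : Cover → Cover) {q : (ℂ × ℂ) × ℝ} (h : q ∈ coverSet) :
    rawMap F q ∈ coverSet := by
  rw [rawMap_of_mem F h]
  exact (F _).2

theorem leafwiseHolomorphicOn_rawMap_comp {F G : Cover → Cover}
    (hF : LeafwiseHolomorphicOn (rawMap F) univ) (hG : LeafwiseHolomorphicOn (rawMap G) univ) :
    LeafwiseHolomorphicOn (rawMap (F ∘ G)) univ := by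
  refine (hF.comp isOpen_univ hG fun q hq => ⟨trivial, rawMap_mem G hq.2⟩).congr isOpen_univ ?_
  rintro q ⟨-, hq⟩
  rw [Function.comp_apply, rawMap_of_mem G hq, rawMap_coe, rawMap_of_mem _ hq]
  rfl

theorem contDiff_jordan (lam : ℂ) : ContDiff ℂ ∞ (jordan lam) := by
  unfold jordan
  fun_prop

theorem contDiff_jordanInv (lam : ℂ) : ContDiff ℂ ∞ (jordanInv lam) := by
  unfold jordanInv
  simp only [div_eq_mul_inv]
  fun_prop

namespace HopfData

variable {D : HopfData}

theorem leafwiseHolomorphicOn_T_zpow (htau : D.tau = 1) (hlam : D.lam = D.mu) (n : ℤ) :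
    LeafwiseHolomorphicOn (rawMap (D.T ^ n : Equiv.Perm Cover)) univ := by
  induction n using Int.induction_on with
  | zero =>
    refine (LeafwiseHolomorphicOn.prodMap contDiff_id 1).congr isOpen_univ ?_
    rintro q ⟨-, hq⟩
    rw [rawMap_of_mem _ hq]
    refine Prod.ext rfl ?_
    exact (realMap_coe 1 ⟨q.2, hq.1⟩).symm
  | succ n ih =>
    rw [zpow_add_one, Equiv.Perm.coe_mul]
    refine leafwiseHolomorphicOn_rawMap_comp ih
      ((LeafwiseHolomorphicOn.prodMap (contDiff_jordan D.lam) D.φ).congr isOpen_univ ?_)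
    rintro q ⟨-, hq⟩
    rw [rawMap_of_mem _ hq, T_apply htau hlam]
  | pred n ih =>
    rw [zpow_sub_one, Equiv.Perm.coe_mul]
    refine leafwiseHolomorphicOn_rawMap_comp ih
      ((LeafwiseHolomorphicOn.prodMap (contDiff_jordanInv D.lam) D.φ⁻¹).congr isOpen_univ ?_)
    rintro q ⟨-, hq⟩
    rw [rawMap_of_mem _ hq]
    exact T_symm_apply htau hlam _

/-- A local representative `G` of `f` and the global lift `F` differ at `q₀` by a deck
transformation `T^n`. By uniqueness of lifts on a connected neighbourhood the same `n` works nearby,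
and `T^n` is itself smooth and leafwise holomorphic. -/
theorem IsLift.exists_leafwiseHolomorphicOn (htau : D.tau = 1) (hlam : D.lam = D.mu)
    {f : D.Reeb → D.Reeb} {F : Cover → Cover} (hF : IsLift f F) (hf : IsLeafwiseHolomorphic f)
    (q₀ : Cover) : ∃ U : Set ((ℂ × ℂ) × ℝ), IsOpen U ∧ q₀.1 ∈ U ∧
      LeafwiseHolomorphicOn (rawMap F) U := by
  obtain ⟨U, G, hU, hq₀, hG, hGs, hGx, hGz⟩ := hf q₀
  obtain ⟨hm, he⟩ := hG q₀ hq₀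
  obtain ⟨n, hn⟩ := proj_eq_iff.mp ((hF.proj_apply q₀).trans he)
  have hG' : LeafwiseHolomorphicOn (rawMap (D.T ^ n : Equiv.Perm Cover) ∘ G) U :=
    (leafwiseHolomorphicOn_T_zpow htau hlam n).comp hU ⟨hGs, hGx, hGz⟩
      fun q hq => ⟨trivial, (hG ⟨q, hq.2⟩ hq.1).1⟩
  have hUo : IsOpen {q : Cover | q.1 ∈ U} := hU.preimage continuous_subtype_val
  obtain ⟨V, hVU, hVo, hVq, hVc⟩ := locallyConnectedSpace_iff_subsets_isOpen_isConnected.mp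
    inferInstance q₀ _ (hUo.mem_nhds hq₀)
  have hGV : ∀ q : Cover, q ∈ V → G q.1 ∈ coverSet := fun q hq => (hG q (hVU hq)).1
  have hcont : ContinuousOn (fun q : Cover => rawMap (D.T ^ n : Equiv.Perm Cover) (G q.1)) V :=
    hG'.contDiffOn.continuousOn.comp continuous_subtype_val.continuousOn
      fun q hq => ⟨hVU hq, q.2⟩
  -- The map `T^n ∘ G` as a self-map of the cover; the default value `q` is never taken on `V`.
  let F' : Cover → Cover := fun q => open Classical in
    if h : G q.1 ∈ coverSet then (D.T ^ n : Equiv.Perm Cover) ⟨G q.1, h⟩ else q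
  have hF' : ∀ (q) (hq : q ∈ V), F' q = (D.T ^ n : Equiv.Perm Cover) ⟨G q.1, hGV q hq⟩ :=
    fun q hq => dif_pos (hGV q hq)
  have hF'c : ContinuousOn F' V := by
    refine continuousOn_iff_continuous_domRestrict.mpr (continuous_induced_rng.mpr ?_)
    refine (continuousOn_iff_continuous_domRestrict.mp hcont).congr fun q => ?_
    change rawMap _ (G q.1.1) = (F' q.1).1
    rw [hF' q.1 q.2, rawMap_of_mem _ (hGV q.1 q.2)]
  have hEq : EqOn F F' V := by
    refine (isCoveringMap_proj htau hlam).eqOn_of_comp_eqOn hVc.isPreconnected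
      hF.continuous.continuousOn hF'c (fun q hq => ?_) hVq ?_
    · rw [Function.comp_apply, Function.comp_apply, hF.proj_apply, hF' q hq,
        (hG q (hVU hq)).2]
      exact (proj_eq_iff.mpr ⟨n, rfl⟩).symm
    · rw [hF' q₀ hVq, hn]
  obtain ⟨W, hW, rfl⟩ := isOpen_induced_iff.mp hVo
  refine ⟨U ∩ W, hU.inter hW, ⟨hq₀, hVq⟩, (hG'.mono inter_subset_left).congr (hU.inter hW) ?_⟩
  rintro q ⟨⟨hqU, hqW⟩, hq⟩
  rw [rawMap_of_mem _ hq, hEq (x := ⟨q, hq⟩) hqW, hF' ⟨q, hq⟩ hqW, Function.comp_apply,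
    rawMap_of_mem]

end HopfData

/-! Maps which are locally leafwise holomorphic. -/

section Local

variable {F : Cover → Cover} (h : ∀ q₀ : Cover, ∃ U : Set ((ℂ × ℂ) × ℝ), IsOpen U ∧ q₀.1 ∈ U ∧
      LeafwiseHolomorphicOn (rawMap F) U)
include h

theorem contDiffOn_rawMap : ContDiffOn ℝ ∞ (rawMap F) coverSet := by
  intro q hq
  obtain ⟨U, hU, hqU, hF⟩ := h ⟨q, hq⟩
  refine (hF.contDiffOn q ⟨hqU, hq⟩).mono_of_mem_nhdsWithin ?_
  exact inter_comm coverSet U ▸ inter_mem_nhdsWithin coverSet (hU.mem_nhds hqU)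

theorem differentiable_rawMap {x : ℝ} (hx : 0 < x) :
    Differentiable ℂ fun z : ℂ × ℂ => (rawMap F (z, x)).1 := by
  intro z
  obtain ⟨U, hU, hqU, hF⟩ := h ⟨(z, x), mk_mem_coverSet hx⟩
  exact hF.differentiableAt (z, x) ⟨hqU, mk_mem_coverSet hx⟩

/-- The definition only controls the height locally; it is locally constant along the leaf `ℂ² ×
{x}`, which is connected. -/
theorem rawMap_height_eq {x : ℝ} (hx : 0 < x) (z w : ℂ × ℂ) :
    (rawMap F (z, x)).2 = (rawMap F (w, x)).2 := by
  have hl : IsLocallyConstant fun z : ℂ × ℂ => (rawMap F (z, x)).2 := by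
    rw [IsLocallyConstant.iff_eventually_eq]
    intro z
    obtain ⟨U, hU, hqU, hF⟩ := h ⟨(z, x), mk_mem_coverSet hx⟩
    filter_upwards [LeafwiseHolomorphicOn.eventually_mem hU
      (q := (z, x)) ⟨hqU, mk_mem_coverSet hx⟩] with w hw
    exact hF.height_eq (w, x) hw (z, x) ⟨hqU, mk_mem_coverSet hx⟩ rfl
  exact hl.apply_eq_of_preconnectedSpace z w

end Local

end LCReeb

/-! ### Rigidity: equivariant families that are small near the boundary -/

namespace LCReeb

open Filter Topology Set Metric

/-- An entire function of subquadratic growth along a sequence of circles is affine. -/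
theorem eq_affine_of_growth {E : Type*} [NormedAddCommGroup E] [NormedSpace ℂ E] [CompleteSpace E]
    {v : ℂ → E} (hv : Differentiable ℂ v) {R M : ℕ → ℝ} (hR : Tendsto R atTop atTop)
    (hM : Tendsto (fun n => M n / R n ^ 2) atTop (𝓝 0))
    (h : ∀ᶠ n in atTop, ∀ s : ℂ, ‖s‖ = R n → ‖v s‖ ≤ M n) (s : ℂ) :
    v s = v 0 + s • deriv v 0 := by
  -- Cauchy's estimate gives `k! * M n / R n ^ k`, and once `R n ≥ 1` this is at most `k! * (M n / R
  -- n ^ 2)`, which tends to `0`.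
  have hk : ∀ k, 2 ≤ k → iteratedDeriv k v 0 = 0 := by
    intro k hk
    obtain ⟨l, rfl⟩ := Nat.exists_eq_add_of_le hk
    have hlim : Tendsto (fun n => (2 + l).factorial * (M n / R n ^ 2)) atTop (𝓝 0) := by
      simpa using hM.const_mul ((2 + l).factorial : ℝ)
    refine norm_le_zero_iff.mp (ge_of_tendsto hlim ?_)
    filter_upwards [h, hR.eventually_ge_atTop 1] with n hn hRn
    have hRn0 : 0 < R n := zero_lt_one.trans_le hRn
    have hM0 : 0 ≤ M n := (norm_nonneg _).trans (hn (R n : ℂ) (by simp [abs_of_pos hRn0]))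
    refine (Complex.norm_iteratedDeriv_le_of_forall_mem_sphere_norm_le (2 + l) hRn0
      hv.diffContOnCl (fun z hz => hn z (by simpa using hz))).trans ?_
    rw [mul_div_assoc]
    gcongr
  have h1 := Complex.hasSum_taylorSeries_of_entire hv 0 s
  have h2 : HasSum (fun n : ℕ => (n.factorial : ℂ)⁻¹ • (s - 0) ^ n • iteratedDeriv n v 0)
      (∑ n ∈ Finset.range 2, (n.factorial : ℂ)⁻¹ • (s - 0) ^ n • iteratedDeriv n v 0) := by
    refine hasSum_sum_of_ne_finset_zero fun k hk2 => ?_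
    rw [Finset.mem_range, not_lt] at hk2
    rw [hk k hk2, smul_zero, smul_zero]
  have h3 := h1.unique h2
  simpa [Finset.sum_range_succ] using h3

/-- The maximum principle propagates smallness from the unit sphere to the unit ball. -/
theorem forall_norm_le_of_continuousOn {G : (ℂ × ℂ) × ℝ → ℂ × ℂ}
    (hG : ContinuousOn G coverSet) (h0 : ∀ z : ℂ × ℂ, z ≠ 0 → G (z, 0) = 0)
    (hd : ∀ x : ℝ, 0 < x → Differentiable ℂ fun z => G (z, x)) {ε : ℝ} (hε : 0 < ε) :
    ∃ δ > 0, ∀ x, 0 < x → x < δ → ∀ z, ‖z‖ ≤ 1 → ‖G (z, x)‖ ≤ ε := by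
  have hne : ∀ z ∈ sphere (0 : ℂ × ℂ) 1, z ≠ 0 := by
    rintro z hz rfl
    simp at hz
  -- The sphere, unlike the ball, gives a compact set avoiding the removed origin, so uniform
  -- continuity is available on it.
  have hK : IsCompact (sphere (0 : ℂ × ℂ) 1 ×ˢ Icc (0 : ℝ) 1) :=
    (isCompact_sphere 0 1).prod isCompact_Icc
  have hsub : sphere (0 : ℂ × ℂ) 1 ×ˢ Icc (0 : ℝ) 1 ⊆ coverSet := fun q hq =>
    ⟨hq.2.1, fun h => hne q.1 hq.1 (congrArg Prod.fst h)⟩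
  obtain ⟨δ, hδ0, hδ⟩ := Metric.uniformContinuousOn_iff.mp
    (hK.uniformContinuousOn_of_continuous (hG.mono hsub)) ε hε
  refine ⟨min δ 1, lt_min hδ0 one_pos, fun x hx hxδ z hz => ?_⟩
  refine Complex.norm_le_of_forall_mem_frontier_norm_le (U := ball (0 : ℂ × ℂ) 1)
    isBounded_ball (hd x hx).diffContOnCl (fun w hw => ?_) ?_
  · rw [frontier_ball _ one_ne_zero] at hw
    have h1 := hδ (w, x) ⟨hw, hx.le, (hxδ.trans_le (min_le_right _ _)).le⟩ (w, 0)
      ⟨hw, le_rfl, zero_le_one⟩ (by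
        rw [Prod.dist_eq, dist_self, Real.dist_0_eq_abs, abs_of_pos hx]
        exact max_lt hδ0 (hxδ.trans_le (min_le_left _ _)))
    rw [h0 w (hne w hw), dist_zero_right] at h1
    exact h1.le
  · rw [closure_ball _ one_ne_zero]
    simpa using hz

theorem jordan_jordanInv {lam : ℂ} (hlam : lam ≠ 0) (z : ℂ × ℂ) :
    jordan lam (jordanInv lam z) = z := by
  refine Prod.ext ?_ ?_ <;> simp only [jordan, jordanInv] <;> field_simp
  ring

theorem jordan_sub (lam : ℂ) (z w : ℂ × ℂ) :
    jordan lam (z - w) = jordan lam z - jordan lam w := by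
  refine Prod.ext ?_ ?_ <;> simp only [jordan, Prod.fst_sub, Prod.snd_sub] <;> ring

theorem norm_le_weightedNorm {K : ℝ} (hK : 0 < K) (z : ℂ × ℂ) :
    min 1 K * ‖z‖ ≤ weightedNorm K z := by
  have h0 : 0 ≤ min 1 K := le_min zero_le_one hK.le
  have h1 := mul_le_mul_of_nonneg_right (min_le_left 1 K) (norm_nonneg z.1)
  have h2 := mul_le_mul_of_nonneg_right (min_le_right 1 K) (norm_nonneg z.2)
  have h3 : 0 ≤ K * ‖z.2‖ := by positivity
  rw [Prod.norm_def, mul_max_of_nonneg _ _ h0]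
  unfold weightedNorm
  exact max_le (by linarith) (by linarith [norm_nonneg z.1])

theorem weightedNorm_le_norm {K : ℝ} (hK : 0 < K) (z : ℂ × ℂ) :
    weightedNorm K z ≤ (1 + K) * ‖z‖ := by
  have h1 := norm_fst_le z
  have h2 := mul_le_mul_of_nonneg_left (norm_snd_le z) hK.le
  unfold weightedNorm
  linarith

section Expanding

variable {φ : halfLineDiff} (hφ : ∀ x : ℝ≥0, 0 < x → x < φ.1 x)
include hφ

theorem tendsto_iterate_inv_nhdsGT {x : ℝ≥0} (hx : 0 < x) :
    Tendsto (fun n => ((φ.1.symm^[n] x : ℝ≥0) : ℝ)) atTop (𝓝[>] 0) := by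
  refine tendsto_nhdsWithin_iff.mpr ⟨?_, Eventually.of_forall fun n => ?_⟩
  · exact (NNReal.continuous_coe.tendsto 0).comp (tendsto_iterate_inv hφ x)
  · have : 0 < φ.1.symm^[n] x := by
      induction n with
      | zero => exact hx
      | succ n ih =>
        rw [Function.iterate_succ_apply']
        exact (pos_iff φ⁻¹ _).mpr ih
    exact this

/-- An invariant function is constant along the backward orbit of `x`, which converges to `0`. -/
theorem eq_zero_of_invariant {c : ℝ → ℂ} (hc : Tendsto c (𝓝[>] 0) (𝓝 0))
    (h : ∀ x, 0 < x → c (realMap φ x) = c x) {x : ℝ} (hx : 0 < x) : c x = 0 := by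
  lift x to ℝ≥0 using hx.le
  have h1 : ∀ n, c (φ.1.symm^[n] x : ℝ≥0) = c x := by
    intro n
    induction n with
    | zero => rfl
    | succ n ih =>
      have hpos : (0 : ℝ) < (φ.1.symm^[n + 1] x : ℝ≥0) := by
        rw [← realMap_zpow_neg_natCast]
        exact realMap_pos _ hx
      rw [← ih, ← h _ hpos, realMap_coe, Function.iterate_succ_apply', Equiv.apply_symm_apply]
  have h2 := hc.comp (tendsto_iterate_inv_nhdsGT hφ (x := x) hx)
  simp only [Function.comp_def, h1] at h2
  exact tendsto_nhds_unique tendsto_const_nhds h2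

variable {lam : ℂ} {g : ℝ → ℂ × ℂ → ℂ × ℂ}
  (hg : ∀ x, 0 < x → Differentiable ℂ (g x))
  (hsmall : ∀ ε > 0, ∃ δ > 0, ∀ x, 0 < x → x < δ → ∀ z, ‖z‖ ≤ 1 → ‖g x z‖ ≤ ε)
  (heq : ∀ x, 0 < x → ∀ z, g (realMap φ x) (jordan lam z) = jordan lam (g x z))

omit hφ in
include heq in
theorem apply_iterate_jordan (n : ℕ) (x : ℝ≥0) (hx : 0 < x) (z : ℂ × ℂ) :
    g x ((jordan lam)^[n] z) = (jordan lam)^[n] (g (φ.1.symm^[n] x : ℝ≥0) z) := by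
  induction n generalizing x with
  | zero => rfl
  | succ n ih =>
    have hpos : 0 < φ.1.symm x := (pos_iff φ⁻¹ x).mpr hx
    have h1 := heq (φ.1.symm x : ℝ≥0) hpos ((jordan lam)^[n] z)
    rw [realMap_coe, Equiv.apply_symm_apply] at h1
    rw [Function.iterate_succ_apply', h1, ih _ hpos, Function.iterate_succ_apply',
      Function.iterate_succ_apply]

-- Write `J` for the Jordan block. Then `g x = Jⁿ ∘ g (φ⁻ⁿ x) ∘ J⁻ⁿ`. On a ball of radius comparable
-- to `b ^ n`, the map `J⁻ⁿ` takes values in the unit ball, where `g (φ⁻ⁿ x)` is bounded by `1` for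
-- large `n`, and `Jⁿ` expands by at most a constant times `a ^ n`. As `a < b ^ 2`, the growth of `g
-- x` on every complex line through `0` is subquadratic.
include hg hsmall heq in
theorem eq_affine_of_equivariant (hlam : 1 < ‖lam‖) {x : ℝ} (hx : 0 < x) (z : ℂ × ℂ) :
    g x z = g x 0 + fderiv ℂ (g x) 0 z := by
  lift x to ℝ≥0 using hx.le
  set v : ℂ → ℂ × ℂ := fun s => g x (s • z) with hv
  have hlin : ∀ s, HasDerivAt (fun s : ℂ => s • z) z s := fun s => by
    simpa using (hasDerivAt_id s).smul_const z
  have hvd : Differentiable ℂ v := fun s =>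
    ((hg x hx) (s • z)).comp s (hlin s).differentiableAt
  have hv0 : deriv v 0 = fderiv ℂ (g x) 0 z := by
    have h0 : HasFDerivAt (g x) (fderiv ℂ (g x) 0) ((0 : ℂ) • z) := by
      rw [zero_smul]
      exact ((hg x hx) 0).hasFDerivAt
    exact (h0.comp_hasDerivAt 0 (hlin 0)).deriv
  suffices h : v 1 = v 0 + (1 : ℂ) • deriv v 0 by
    rw [hv0] at h
    simpa only [hv, one_smul, zero_smul] using h
  -- With `‖lam‖ = 1 + 4ε` one has `a = 1 + 5ε` and `b = 1 + 3ε`, hence `a < b ^ 2`.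
  set ε : ℝ := (‖lam‖ - 1) / 4 with hε
  have hε0 : 0 < ε := by linarith
  set K : ℝ := ε⁻¹ with hKdef
  have hK : 0 < K := inv_pos.mpr hε0
  have hKε : ε * K = 1 := mul_inv_cancel₀ hε0.ne'
  set a : ℝ := ‖lam‖ + ε with ha
  set b : ℝ := ‖lam‖ - ε with hb
  have hb1 : 1 < b := by linarith
  have hab : a / b ^ 2 < 1 := by
    rw [div_lt_one (by positivity)]
    nlinarith
  have ha0 : 0 < a := by linarith
  have hb0 : 0 < b := by linarith
  set c : ℝ := min 1 K with hc
  have hc0 : 0 < c := lt_min one_pos hK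
  -- Adding `1` keeps the radius `c / N * b ^ n` meaningful when `z = 0`.
  set N : ℝ := weightedNorm K z + 1 with hN
  have hN0 : 0 < N := by linarith [weightedNorm_nonneg hK z]
  have hup : ∀ n w, weightedNorm K ((jordan lam)^[n] w) ≤ a ^ n * weightedNorm K w := by
    intro n w
    induction n with
    | zero => simp
    | succ n ih =>
      rw [Function.iterate_succ_apply']
      calc _ ≤ a * weightedNorm K ((jordan lam)^[n] w) := weightedNorm_jordan_le hK hKε _ _
        _ ≤ a * (a ^ n * weightedNorm K w) := mul_le_mul_of_nonneg_left ih ha0.le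
        _ = _ := by ring
  have hlow : ∀ n w, b ^ n * weightedNorm K w ≤ weightedNorm K ((jordan lam)^[n] w) := by
    intro n w
    induction n with
    | zero => simp
    | succ n ih =>
      rw [Function.iterate_succ_apply']
      calc b ^ (n + 1) * weightedNorm K w = b * (b ^ n * weightedNorm K w) := by ring
        _ ≤ b * weightedNorm K ((jordan lam)^[n] w) := mul_le_mul_of_nonneg_left ih hb0.le
        _ ≤ _ := le_weightedNorm_jordan hK hKε _ _
  have hlam0 : lam ≠ 0 := norm_pos_iff.mp (zero_lt_one.trans hlam)
  have hinv : ∀ n w, (jordan lam)^[n] ((jordanInv lam)^[n] w) = w := fun n w =>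
    Function.RightInverse.iterate (jordan_jordanInv hlam0) n w
  refine eq_affine_of_growth hvd (R := fun n => c / N * b ^ n)
    (M := fun n => a ^ n * (1 + K) / c) ?_ ?_ ?_ 1
  · exact (tendsto_pow_atTop_atTop_of_one_lt hb1).const_mul_atTop (by positivity)
  · have h1 : (fun n : ℕ => a ^ n * (1 + K) / c / (c / N * b ^ n) ^ 2) =
        fun n => (1 + K) / c / (c / N) ^ 2 * (a / b ^ 2) ^ n := by
      funext n
      rw [div_pow a, mul_pow, ← pow_mul, ← pow_mul, mul_comm n 2]
      field_simp
    rw [h1]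
    simpa using (tendsto_pow_atTop_nhds_zero_of_lt_one (by positivity) hab).const_mul
      ((1 + K) / c / (c / N) ^ 2)
  · obtain ⟨δ, hδ0, hδ⟩ := hsmall 1 one_pos
    have hev := (tendsto_nhdsWithin_iff.mp (tendsto_iterate_inv_nhdsGT hφ (x := x) hx))
    filter_upwards [hev.1.eventually_lt_const hδ0, hev.2] with n hn hn0 s hs
    set w := (jordanInv lam)^[n] (s • z) with hw
    have hwn : ‖w‖ ≤ 1 := by
      have h1 := hlow n w
      rw [hw, hinv] at h1
      have h2 : weightedNorm K (s • z) = ‖s‖ * weightedNorm K z := by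
        simp only [weightedNorm, Prod.smul_fst, Prod.smul_snd, norm_smul]
        ring
      have h3 : ‖s‖ * weightedNorm K z ≤ b ^ n * c := by
        rw [hs]
        calc c / N * b ^ n * weightedNorm K z ≤ c / N * b ^ n * N := by
              gcongr
              linarith
          _ = b ^ n * c := by field_simp
      rw [h2] at h1
      have h4 := le_of_mul_le_mul_left (h1.trans h3) (by positivity)
      have h5 := (norm_le_weightedNorm hK w).trans h4
      exact le_of_mul_le_mul_left (by simpa using h5) hc0
    have h6 : v s = (jordan lam)^[n] (g (φ.1.symm^[n] x : ℝ≥0) w) := by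
      rw [← apply_iterate_jordan heq n x hx, hw, hinv]
    have h7 := hδ _ hn0 hn w hwn
    rw [le_div_iff₀ hc0, mul_comm, h6]
    refine (norm_le_weightedNorm hK _).trans ((hup n _).trans ?_)
    gcongr
    refine (weightedNorm_le_norm hK _).trans ?_
    exact mul_le_of_le_one_right (by positivity) h7

include hg hsmall heq in
/-- A family of entire maps which is equivariant under the Jordan block and small near the
boundary consists of constant maps. -/
theorem eq_const_of_equivariant (hlam : 1 < ‖lam‖) {x : ℝ} (hx : 0 < x) (z : ℂ × ℂ) :
    g x z = g x 0 := by
  have hlam0 : lam ≠ 0 := norm_pos_iff.mp (zero_lt_one.trans hlam)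
  let L : ℝ → ℂ × ℂ →L[ℂ] ℂ × ℂ := fun x => fderiv ℂ (g x) 0
  have haff : ∀ x, 0 < x → ∀ z, L x z = g x z - g x 0 := fun x hx z => by
    rw [eq_affine_of_equivariant hφ hg hsmall heq hlam hx z, add_sub_cancel_left]
  have hL : ∀ x, 0 < x → ∀ z, L (realMap φ x) (jordan lam z) = jordan lam (L x z) := by
    intro x hx z
    have h0 : jordan lam 0 = 0 := by simp [jordan]
    have h1 := heq x hx 0
    rw [h0] at h1
    rw [haff _ (realMap_pos φ hx), haff x hx, jordan_sub, heq x hx z, h1]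
  have hlim : ∀ z : ℂ × ℂ, ‖z‖ ≤ 1 → Tendsto (fun x => L x z) (𝓝[>] 0) (𝓝 0) := by
    intro z hz
    rw [Metric.tendsto_nhds]
    intro ε hε
    obtain ⟨δ, hδ0, hδ⟩ := hsmall (ε / 3) (by positivity)
    filter_upwards [Ioo_mem_nhdsGT hδ0] with x hx
    rw [dist_zero_right, haff x hx.1]
    have h1 := hδ x hx.1 hx.2 z hz
    have h2 := hδ x hx.1 hx.2 0 (by simp)
    linarith [norm_sub_le (g x z) (g x 0)]
  have hlim1 : ∀ z : ℂ × ℂ, ‖z‖ ≤ 1 → Tendsto (fun x => (L x z).1) (𝓝[>] 0) (𝓝 0) :=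
    fun z hz => (continuous_fst.tendsto (0 : ℂ × ℂ)).comp (hlim z hz)
  have hlim2 : ∀ z : ℂ × ℂ, ‖z‖ ≤ 1 → Tendsto (fun x => (L x z).2) (𝓝[>] 0) (𝓝 0) :=
    fun z hz => (continuous_snd.tendsto (0 : ℂ × ℂ)).comp (hlim z hz)
  have n1 : ‖((1, 0) : ℂ × ℂ)‖ ≤ 1 := by simp [Prod.norm_def]
  have n2 : ‖((0, 1) : ℂ × ℂ)‖ ≤ 1 := by simp [Prod.norm_def]
  have j1 : jordan lam (1, 0) = lam • ((1, 0) : ℂ × ℂ) := by simp [jordan]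
  have j2 : jordan lam (0, 1) = (1, 0) + lam • ((0, 1) : ℂ × ℂ) := by simp [jordan]
  have e1 : ∀ x, 0 < x → lam • L (realMap φ x) (1, 0) = jordan lam (L x (1, 0)) :=
    fun x hx => by rw [← hL x hx, j1, map_smul]
  have e2 : ∀ x, 0 < x → L (realMap φ x) (1, 0) + lam • L (realMap φ x) (0, 1) =
      jordan lam (L x (0, 1)) := fun x hx => by rw [← hL x hx, j2, map_add, map_smul]
  -- The order of the four entries matters: each becomes `φ`-invariant only after the earlier ones
  -- that the Jordan block couples to it are known to vanish.
  have h21 : ∀ x, 0 < x → (L x (1, 0)).2 = 0 := fun x hx =>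
    eq_zero_of_invariant hφ (hlim2 _ n1) (fun x hx => by
      have h := congrArg Prod.snd (e1 x hx)
      exact mul_left_cancel₀ hlam0 h) hx
  have h11 : ∀ x, 0 < x → (L x (1, 0)).1 = 0 := fun x hx =>
    eq_zero_of_invariant hφ (hlim1 _ n1) (fun x hx => by
      have h := congrArg Prod.fst (e1 x hx)
      simp only [jordan, h21 x hx, add_zero] at h
      exact mul_left_cancel₀ hlam0 h) hx
  have h10 : ∀ x, 0 < x → L x (1, 0) = 0 := fun x hx => Prod.ext (h11 x hx) (h21 x hx)
  have h22 : ∀ x, 0 < x → (L x (0, 1)).2 = 0 := fun x hx =>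
    eq_zero_of_invariant hφ (hlim2 _ n2) (fun x hx => by
      have h := congrArg Prod.snd (e2 x hx)
      rw [h10 _ (realMap_pos φ hx), zero_add] at h
      exact mul_left_cancel₀ hlam0 h) hx
  have h12 : ∀ x, 0 < x → (L x (0, 1)).1 = 0 := fun x hx =>
    eq_zero_of_invariant hφ (hlim1 _ n2) (fun x hx => by
      have h := congrArg Prod.fst (e2 x hx)
      rw [h10 _ (realMap_pos φ hx), zero_add] at h
      simp only [jordan, h22 x hx, add_zero] at h
      exact mul_left_cancel₀ hlam0 h) hx
  have hz : z = z.1 • ((1, 0) : ℂ × ℂ) + z.2 • ((0, 1) : ℂ × ℂ) := by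
    refine Prod.ext ?_ ?_ <;> simp
  have hLz : L x z = 0 := by
    rw [hz, map_add, map_smul, map_smul, h10 x hx,
      show L x (0, 1) = 0 from Prod.ext (h12 x hx) (h22 x hx), smul_zero, smul_zero, add_zero]
  rw [haff x hx] at hLz
  exact sub_eq_zero.mp hLz

end Expanding

end LCReeb

/-! ### From the semidirect product to automorphisms -/

namespace LCReeb

open Filter Topology Set

namespace HopfData

variable (D : HopfData)

/-- The semidirect product `S ⋊ Z` of the solution space and the centralizer. -/
abbrev Semidirect : Type :=
  Multiplicative (solutionSpace D.φ D.lam) ⋊[precompAction D.φ D.lam] centralizerOf D.φ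

variable {D}

/-- The translation part of the map `(z, x) ↦ (z + β (η x), η x)`. -/
noncomputable def translation (s : D.Semidirect) (x : ℝ) : ℂ × ℂ :=
  (extendZero s.left.toAdd.1.1 (realMap s.right.1 x),
    extendZero s.left.toAdd.1.2 (realMap s.right.1 x))

theorem translation_zero (s : D.Semidirect) : translation s 0 = 0 := by
  simp [translation, realMap_zero, extendZero_zero]

theorem translation_of_pos (s : D.Semidirect) {x : ℝ} (hx : 0 < x) :
    translation s x = (s.left.toAdd.1.1 (onPos s.right.1 ⟨x, hx⟩),
      s.left.toAdd.1.2 (onPos s.right.1 ⟨x, hx⟩)) := by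
  rw [translation, extendZero_realMap _ _ hx, extendZero_realMap _ _ hx]

/-- The map `(z, x) ↦ (z + β (η x), η x)`, on the ambient space. -/
noncomputable def ambientMap (s : D.Semidirect) (q : (ℂ × ℂ) × ℝ) : (ℂ × ℂ) × ℝ :=
  (q.1 + translation s q.2, realMap s.right.1 q.2)

theorem ambientMap_mem (s : D.Semidirect) {q : (ℂ × ℂ) × ℝ} (hq : q ∈ coverSet) :
    ambientMap s q ∈ coverSet := by
  refine ⟨realMap_nonneg _ _, fun h => hq.2 ?_⟩
  have h2 : realMap s.right.1 q.2 = 0 := congrArg Prod.snd h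
  have h3 : q.2 = 0 := by
    by_contra hne
    exact (realMap_pos s.right.1 (lt_of_le_of_ne hq.1 (Ne.symm hne))).ne' h2
  have h1 : q.1 + translation s q.2 = 0 := congrArg Prod.fst h
  rw [h3, translation_zero, add_zero] at h1
  exact Prod.ext h1 h3

/-- The map `(z, x) ↦ (z + β (η x), η x)` of the cover. -/
noncomputable def coverMap (s : D.Semidirect) (q : Cover) : Cover :=
  ⟨ambientMap s q.1, ambientMap_mem s q.2⟩

/-- This is the group law: `β + β' ∘ η⁻¹` evaluated at `η (η' x)` is `β (η (η' x)) + β' (η' x)`. -/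
theorem translation_mul (s t : D.Semidirect) {x : ℝ} (hx : 0 ≤ x) :
    translation (s * t) x = translation t x + translation s (realMap t.right.1 x) := by
  rcases eq_or_lt_of_le hx with rfl | hx
  · rw [realMap_zero, translation_zero, translation_zero, translation_zero, add_zero]
  · have hx' := realMap_pos t.right.1 hx
    have hp : (⟨realMap t.right.1 x, hx'⟩ : Ioi (0 : ℝ)) = onPos t.right.1 ⟨x, hx⟩ :=
      Subtype.ext (coe_onPos t.right.1 ⟨x, hx⟩).symm
    have hc : onPos (s.right⁻¹).1 (onPos (s.right * t.right).1 ⟨x, hx⟩) =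
        onPos t.right.1 ⟨x, hx⟩ := by
      rw [← onPos_mul, ← Subgroup.coe_mul, inv_mul_cancel_left]
    rw [translation_of_pos _ hx, translation_of_pos _ hx, translation_of_pos _ hx', hp]
    refine Prod.ext ?_ ?_
    · change s.left.toAdd.1.1 (onPos (s.right * t.right).1 ⟨x, hx⟩) +
        t.left.toAdd.1.1 (onPos (s.right⁻¹).1 (onPos (s.right * t.right).1 ⟨x, hx⟩)) = _
      rw [hc]
      exact add_comm _ _
    · change s.left.toAdd.1.2 (onPos (s.right * t.right).1 ⟨x, hx⟩) +
        t.left.toAdd.1.2 (onPos (s.right⁻¹).1 (onPos (s.right * t.right).1 ⟨x, hx⟩)) = _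
      rw [hc]
      exact add_comm _ _

theorem coverMap_mul (s t : D.Semidirect) (q : Cover) :
    coverMap (s * t) q = coverMap s (coverMap t q) := by
  refine Subtype.ext (Prod.ext ?_ ?_)
  · change q.1.1 + translation (s * t) q.1.2 =
      q.1.1 + translation t q.1.2 + translation s (realMap t.right.1 q.1.2)
    rw [translation_mul s t q.2.1, add_assoc]
  · exact realMap_mul s.right.1 t.right.1 q.1.2

theorem coverMap_one (q : Cover) : coverMap (1 : D.Semidirect) q = q := by
  have h : translation (1 : D.Semidirect) q.1.2 = 0 := by
    rcases eq_or_lt_of_le q.2.1 with h | h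
    · rw [← h, translation_zero]
    · rw [translation_of_pos _ h]
      rfl
  refine Subtype.ext (Prod.ext ?_ ?_)
  · change q.1.1 + translation (1 : D.Semidirect) q.1.2 = q.1.1
    rw [h, add_zero]
  · exact realMap_coe 1 (height q)

theorem jordan_add (lam : ℂ) (z w : ℂ × ℂ) :
    jordan lam (z + w) = jordan lam z + jordan lam w := by
  refine Prod.ext ?_ ?_ <;> simp only [jordan, Prod.fst_add, Prod.snd_add] <;> ring

theorem realMap_comm (η : centralizerOf D.φ) (x : ℝ) :
    realMap η.1 (realMap D.φ x) = realMap D.φ (realMap η.1 x) := by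
  have h : D.φ * η.1 = η.1 * D.φ := Subgroup.mem_centralizer_iff.mp η.2 D.φ rfl
  rw [← realMap_mul, ← realMap_mul, h]

/-- The two functional equations are the two components of this identity. With the commutation of
`η` and `φ` it makes `coverMap` descend to `R`. -/
theorem translation_realMap (s : D.Semidirect) {x : ℝ} (hx : 0 ≤ x) :
    translation s (realMap D.φ x) = jordan D.lam (translation s x) := by
  rcases eq_or_lt_of_le hx with rfl | hx
  · rw [realMap_zero, translation_zero]
    exact Prod.ext (by simp [jordan]) (by simp [jordan])
  · have hp : (⟨realMap D.φ x, realMap_pos D.φ hx⟩ : Ioi (0 : ℝ)) = onPos D.φ ⟨x, hx⟩ :=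
      Subtype.ext (coe_onPos D.φ ⟨x, hx⟩).symm
    rw [translation_of_pos _ (realMap_pos D.φ hx), translation_of_pos _ hx, hp, onPos_comm,
      s.left.toAdd.2.2.2.1, s.left.toAdd.2.2.2.2]
    rfl

theorem coverMap_T (htau : D.tau = 1) (hlam : D.lam = D.mu) (s : D.Semidirect) (q : Cover) :
    coverMap s (D.T q) = D.T (coverMap s q) := by
  refine Subtype.ext ?_
  rw [T_apply htau hlam]
  change ((D.T q).1.1 + translation s (D.T q).1.2, realMap s.right.1 (D.T q).1.2) =
    (jordan D.lam (q.1.1 + translation s q.1.2), realMap D.φ (realMap s.right.1 q.1.2))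
  rw [T_apply htau hlam, jordan_add, realMap_comm, translation_realMap s q.2.1]

theorem coverMap_of_height_eq_zero (s : D.Semidirect) {q : Cover} (hq : height q = 0) :
    coverMap s q = q := by
  have hq2 : q.1.2 = 0 := congrArg NNReal.toReal hq
  refine Subtype.ext (Prod.ext ?_ ?_)
  · change q.1.1 + translation s q.1.2 = q.1.1
    rw [hq2, translation_zero, add_zero]
  · change realMap s.right.1 q.1.2 = q.1.2
    rw [hq2, realMap_zero]

theorem height_coverMap (s : D.Semidirect) (q : Cover) :
    height (coverMap s q) = s.right.1.1 (height q) :=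
  NNReal.eq (realMap_coe s.right.1 (height q))

theorem contDiffOn_ambientMap (hφ : InfinitelyTangentToId D.φ) (s : D.Semidirect) :
    ContDiffOn ℝ ∞ (ambientMap s) coverSet := by
  have hη : ContDiffOn ℝ ∞ (fun q : (ℂ × ℂ) × ℝ => realMap s.right.1 q.2) coverSet :=
    (contDiffOn_realMap s.right.1).comp contDiff_snd.contDiffOn fun q hq => hq.1
  obtain ⟨h1, h2⟩ := contDiffOn_extendZero_of_mem_solutionSpace D.expanding hφ
    (one_lt_norm_lam (D := D)) s.left.toAdd.2
  have hm : MapsTo (fun q : (ℂ × ℂ) × ℝ => realMap s.right.1 q.2) coverSet (Ici 0) :=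
    fun q _ => realMap_nonneg _ _
  exact (contDiff_fst.contDiffOn.add ((h1.comp hη hm).prodMk (h2.comp hη hm))).prodMk hη

theorem continuous_coverMap (hφ : InfinitelyTangentToId D.φ) (s : D.Semidirect) :
    Continuous (coverMap s) :=
  Continuous.subtype_mk ((contDiffOn_ambientMap hφ s).continuousOn.comp_continuous
    continuous_subtype_val fun q => q.2) _

theorem proj_eq_proj_of_commute {F : Cover → Cover} (hF : ∀ q, F (D.T q) = D.T (F q))
    {q q' : Cover} (h : D.proj q = D.proj q') : D.proj (F q) = D.proj (F q') := by
  obtain ⟨n, rfl⟩ := proj_eq_iff.mp h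
  clear h
  induction n using Int.induction_on with
  | zero => rfl
  | succ n ih => rw [add_comm, zpow_add, zpow_one, Equiv.Perm.mul_apply, hF, proj_T, ih]
  | pred n ih =>
    rw [← ih, ← proj_T, ← hF, ← Equiv.Perm.mul_apply, ← zpow_one_add]
    congr 5
    ring

theorem proj_surjective : Function.Surjective D.proj := Quotient.mk_surjective

variable (htau : D.tau = 1) (hlam : D.lam = D.mu)

/-- The self-map of `R` induced by `(z, x) ↦ (z + β (η x), η x)`. -/
noncomputable def reebMap (s : D.Semidirect) : D.Reeb → D.Reeb :=
  Quotient.lift (fun q => D.proj (coverMap s q)) fun _ _ h =>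
    proj_eq_proj_of_commute (coverMap_T htau hlam s)
      (Quotient.sound (s := MulAction.orbitRel (Subgroup.zpowers D.T) Cover) h)

theorem reebMap_proj (s : D.Semidirect) (q : Cover) :
    reebMap htau hlam s (D.proj q) = D.proj (coverMap s q) := rfl

theorem reebMap_mul (s t : D.Semidirect) (r : D.Reeb) :
    reebMap htau hlam (s * t) r = reebMap htau hlam s (reebMap htau hlam t r) := by
  obtain ⟨q, rfl⟩ := proj_surjective r
  simp only [reebMap_proj, coverMap_mul]

theorem reebMap_one (r : D.Reeb) : reebMap htau hlam 1 r = r := by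
  obtain ⟨q, rfl⟩ := proj_surjective r
  rw [reebMap_proj, coverMap_one]

theorem isLeafwiseHolomorphic_reebMap (hφ : InfinitelyTangentToId D.φ) (s : D.Semidirect) :
    IsLeafwiseHolomorphic (reebMap htau hlam s) := fun _ =>
  ⟨univ, ambientMap s, isOpen_univ, trivial, fun q _ => ⟨ambientMap_mem s q.2, rfl⟩,
    (contDiffOn_ambientMap hφ s).mono inter_subset_right,
    fun q _ q' _ h => by simp only [ambientMap, h],
    fun q _ => by
      simp only [ambientMap]
      fun_prop⟩

theorem isLeaf_image_reebMap (s : D.Semidirect) {L : Set D.Reeb} (hL : D.IsLeaf L) :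
    D.IsLeaf (reebMap htau hlam s '' L) := by
  obtain ⟨x, rfl⟩ := hL
  refine ⟨s.right.1.1 x, Subset.antisymm ?_ ?_⟩
  · rintro _ ⟨_, ⟨q, rfl, rfl⟩, rfl⟩
    exact ⟨coverMap s q, height_coverMap s q, rfl⟩
  · rintro _ ⟨q, hq, rfl⟩
    refine ⟨D.proj (coverMap s⁻¹ q), ⟨coverMap s⁻¹ q, ?_, rfl⟩, ?_⟩
    · change height _ = _
      rw [height_coverMap, show height q = s.right.1.1 x from hq]
      exact s.right.1.1.symm_apply_apply x
    · rw [reebMap_proj, ← coverMap_mul, mul_inv_cancel, coverMap_one]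

/-- The permutation of `R` induced by `(z, x) ↦ (z + β (η x), η x)`. -/
noncomputable def reebPerm (s : D.Semidirect) : Equiv.Perm D.Reeb where
  toFun := reebMap htau hlam s
  invFun := reebMap htau hlam s⁻¹
  left_inv r := by rw [← reebMap_mul, inv_mul_cancel, reebMap_one]
  right_inv r := by rw [← reebMap_mul, mul_inv_cancel, reebMap_one]

theorem reebPerm_mem_autR (hφ : InfinitelyTangentToId D.φ) (s : D.Semidirect) :
    reebPerm htau hlam s ∈ D.autR := by
  refine ⟨isLeafwiseHolomorphic_reebMap htau hlam hφ s,
    isLeafwiseHolomorphic_reebMap htau hlam hφ s⁻¹, fun L => ⟨fun h => ?_, fun h =>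
    isLeaf_image_reebMap htau hlam s h⟩⟩
  have h1 := isLeaf_image_reebMap htau hlam s⁻¹ h
  have h2 : reebMap htau hlam s⁻¹ '' (reebPerm htau hlam s '' L) = L :=
    (reebPerm htau hlam s).symm_image_image L
  rwa [h2] at h1

/-- The homomorphism from the semidirect product to `Aut(R, H)`. -/
noncomputable def toAutRH (hφ : InfinitelyTangentToId D.φ) : D.Semidirect →* D.autRH where
  toFun s := ⟨⟨reebPerm htau hlam s, reebPerm_mem_autR htau hlam hφ s⟩, by
    rw [autRH, mem_fixingSubgroup_iff]
    rintro _ ⟨q, hq, rfl⟩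
    change D.proj (coverMap s q) = D.proj q
    rw [coverMap_of_height_eq_zero s hq]⟩
  map_one' := Subtype.ext (Subtype.ext (Equiv.ext (reebMap_one htau hlam)))
  map_mul' s t := Subtype.ext (Subtype.ext (Equiv.ext (reebMap_mul htau hlam s t)))

theorem toAutRH_apply_proj (hφ : InfinitelyTangentToId D.φ) (s : D.Semidirect) (q : Cover) :
    (toAutRH htau hlam hφ s).1.1 (D.proj q) = D.proj (coverMap s q) := rfl

theorem isLift_coverMap (hφ : InfinitelyTangentToId D.φ) (s : D.Semidirect) :
    IsLift (reebMap htau hlam s) (coverMap s) where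
  continuous := continuous_coverMap hφ s
  base := coverMap_of_height_eq_zero s rfl
  proj_apply _ := rfl

/-- If the induced map is the identity, then `coverMap s` and the identity are lifts of the same map
fixing the base point, so they coincide. The height then shows `η = 1`, and the images of the points
`(0, x)` show `β = 0`. -/
theorem toAutRH_injective (hφ : InfinitelyTangentToId D.φ) :
    Function.Injective (toAutRH htau hlam hφ) := by
  refine (injective_iff_map_eq_one _).mpr fun s hs => ?_
  have h1 : reebMap htau hlam s = id := funext fun r => by
    have := congrArg (fun f : D.autRH => f.1.1 r) hs
    exact this
  have h2 : coverMap s = id := by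
    refine IsLift.unique htau hlam (isLift_coverMap htau hlam hφ s) ?_
    rw [h1]
    exact IsLift.id
  have h3 : s.right = 1 := by
    refine Subtype.ext (Subtype.ext (Equiv.ext fun x => ?_))
    have h := height_coverMap s ⟨((1, 0), x), base_mem_coverSet x x.2⟩
    rw [h2] at h
    exact h.symm
  have h4 : ∀ x : Ioi (0 : ℝ), (s.left.toAdd.1.1 x, s.left.toAdd.1.2 x) = (0 : ℂ × ℂ) := by
    intro x
    have h := congrArg (fun q : Cover => q.1.1) (congrFun h2 (mkPos 0 x))
    change (0 : ℂ × ℂ) + translation s x.1 = 0 at h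
    rw [zero_add, translation_of_pos s x.2, h3] at h
    exact h
  refine SemidirectProduct.ext ?_ h3
  refine Multiplicative.toAdd.injective (Subtype.ext (Prod.ext ?_ ?_))
  · exact funext fun x => congrArg Prod.fst (h4 x)
  · exact funext fun x => congrArg Prod.snd (h4 x)

end HopfData

end LCReeb

/-! ### Every automorphism fixing the boundary comes from the semidirect product -/

namespace LCReeb

open Filter Topology Set

namespace HopfData

variable {D : HopfData} (htau : D.tau = 1) (hlam : D.lam = D.mu)

/-- The point `((1, 0), x)` of the cover. -/
def transversal (x : ℝ≥0) : Cover := ⟨((1, 0), x), base_mem_coverSet x x.2⟩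

/-- The lift of an automorphism which fixes the boundary leaf. -/
structure IsAutLift (F : Cover → Cover) : Prop where
  exists_leafwiseHolomorphicOn : ∀ q₀ : Cover, ∃ U : Set ((ℂ × ℂ) × ℝ), IsOpen U ∧ q₀.1 ∈ U ∧
    LeafwiseHolomorphicOn (rawMap F) U
  eq_self : ∀ q, height q = 0 → F q = q
  apply_T : ∀ q, F (D.T q) = D.T (F q)

namespace IsAutLift

/-- The action of a lift on the transverse coordinate. -/
noncomputable def transverse (F : Cover → Cover) (x : ℝ≥0) : ℝ≥0 := height (F (transversal x))

variable {F : Cover → Cover}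

theorem height_apply (hF : IsAutLift (D := D) F) (q : Cover) :
    height (F q) = transverse F (height q) := by
  rcases eq_or_ne (height q) 0 with h | h
  · have h1 : height (transversal (0 : ℝ≥0)) = 0 := rfl
    rw [hF.eq_self q h, h, transverse, hF.eq_self _ h1, h1]
  · have hpos : 0 < q.1.2 := lt_of_le_of_ne q.2.1 fun h0 => h (NNReal.eq h0.symm)
    have h1 := rawMap_height_eq hF.exists_leafwiseHolomorphicOn hpos q.1.1 (1, 0)
    refine NNReal.eq ?_
    have h2 : rawMap F (q.1.1, q.1.2) = (F q).1 := rawMap_coe F q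
    have h3 : rawMap F ((1, 0), q.1.2) = (F (transversal (height q))).1 :=
      rawMap_coe F (transversal (height q))
    rw [h2, h3] at h1
    exact h1

theorem transverse_comp (hF : IsAutLift (D := D) F) (G : Cover → Cover) (x : ℝ≥0) :
    transverse (F ∘ G) x = transverse F (transverse G x) :=
  hF.height_apply _

theorem halfLineSmooth_transverse (hF : IsAutLift (D := D) F) :
    HalfLineSmooth (transverse F) := by
  have h1 : ContDiffOn ℝ ∞ (fun t : ℝ => (rawMap F ((1, 0), t)).2) (Ici 0) :=
    ((contDiffOn_rawMap hF.exists_leafwiseHolomorphicOn).comp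
      (contDiff_const.prodMk contDiff_id).contDiffOn
      fun t ht => base_mem_coverSet t ht).snd
  refine h1.congr fun t ht => ?_
  lift t to ℝ≥0 using ht
  rw [Real.toNNReal_coe]
  exact congrArg Prod.snd (rawMap_coe F (transversal t)).symm

theorem transverse_comm (hF : IsAutLift (D := D) F) (x : ℝ≥0) :
    transverse F (D.φ.1 x) = D.φ.1 (transverse F x) := by
  have h := hF.height_apply (D.T (transversal x))
  rw [hF.apply_T, height_T, height_T] at h
  exact h.symm

/-- Invertible lifts act on the transverse coordinate through the centralizer. -/
noncomputable def toCentralizer {G : Cover → Cover} (hF : IsAutLift (D := D) F)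
    (hG : IsAutLift (D := D) G) (hFG : F ∘ G = id) (hGF : G ∘ F = id) : centralizerOf D.φ :=
  ⟨⟨{ toFun := transverse F
      invFun := transverse G
      left_inv := fun x => by rw [← hG.transverse_comp, hGF]; rfl
      right_inv := fun x => by rw [← hF.transverse_comp, hFG]; rfl },
    hF.halfLineSmooth_transverse, hG.halfLineSmooth_transverse⟩, by
    rw [centralizerOf, Subgroup.mem_centralizer_iff]
    rintro _ rfl
    exact Subtype.ext (Equiv.ext fun x => (hF.transverse_comm x).symm)⟩

/-- The translation part of a lift. -/
noncomputable def offset (F : Cover → Cover) (x : Ioi (0 : ℝ)) : ℂ × ℂ := (F (mkPos 0 x)).1.1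

include htau hlam in
theorem rawMap_jordan (hF : IsAutLift (D := D) F) {x : ℝ} (hx : 0 < x) (z : ℂ × ℂ) :
    (rawMap F (jordan D.lam z, realMap D.φ x)).1 = jordan D.lam (rawMap F (z, x)).1 := by
  have h1 : (D.T (mkPos z ⟨x, hx⟩)).1 = (jordan D.lam z, realMap D.φ x) := T_apply htau hlam _
  have h2 : rawMap F (z, x) = (F (mkPos z ⟨x, hx⟩)).1 := rawMap_coe F (mkPos z ⟨x, hx⟩)
  rw [← h1, rawMap_coe, hF.apply_T, T_apply htau hlam, h2]

-- Rigidity applies to the displacement of `F`: it is equivariant because the Jordan block is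
-- linear, and small near the boundary because `F` is continuous and equals the identity at height
-- `0`.
include htau hlam in
theorem apply_mkPos (hF : IsAutLift (D := D) F) (z : ℂ × ℂ) (x : Ioi (0 : ℝ)) :
    (F (mkPos z x)).1.1 = z + offset F x := by
  have hd : ∀ x : ℝ, 0 < x → Differentiable ℂ fun z => (rawMap F (z, x)).1 - z := fun x hx =>
    (differentiable_rawMap hF.exists_leafwiseHolomorphicOn hx).sub differentiable_id
  have h := eq_const_of_equivariant D.expanding (lam := D.lam)
    (g := fun x z => (rawMap F (z, x)).1 - z) hd (fun ε hε => ?_) (fun x hx z => ?_)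
    (one_lt_norm_lam (D := D)) x.2 z
  · rw [sub_zero] at h
    have h1 : rawMap F (z, x.1) = (F (mkPos z x)).1 := rawMap_coe F (mkPos z x)
    have h2 : rawMap F (0, x.1) = (F (mkPos 0 x)).1 := rawMap_coe F (mkPos 0 x)
    rw [h1, h2, sub_eq_iff_eq_add'] at h
    exact h
  · refine forall_norm_le_of_continuousOn (G := fun q => (rawMap F q).1 - q.1) ?_ ?_ hd hε
    · exact (contDiffOn_rawMap hF.exists_leafwiseHolomorphicOn).continuousOn.fst.sub
        continuous_fst.continuousOn
    · intro z hz
      have hm : ((z, 0) : (ℂ × ℂ) × ℝ) ∈ coverSet := ⟨le_rfl, fun h => hz (congrArg Prod.fst h)⟩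
      have h1 : rawMap F (z, 0) = (z, 0) := by
        rw [rawMap_of_mem F hm, hF.eq_self _ rfl]
      simp only [h1, sub_self]
  · simp only [rawMap_jordan htau hlam hF hx, jordan_sub]

include htau hlam in
theorem offset_onPos (hF : IsAutLift (D := D) F) (x : Ioi (0 : ℝ)) :
    offset F (onPos D.φ x) = jordan D.lam (offset F x) := by
  have h := rawMap_jordan htau hlam hF x.2 0
  have h0 : jordan D.lam 0 = 0 := Prod.ext (by simp [jordan]) (by simp [jordan])
  have h2 : rawMap F (0, x.1) = (F (mkPos 0 x)).1 := rawMap_coe F (mkPos 0 x)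
  have h3 : rawMap F (0, (onPos D.φ x : ℝ)) = (F (mkPos 0 (onPos D.φ x))).1 :=
    rawMap_coe F (mkPos 0 (onPos D.φ x))
  rw [h0, h2, ← coe_onPos, h3] at h
  exact h

include htau hlam in
theorem offset_mem_solutionSpace (hF : IsAutLift (D := D) F) :
    ((fun x => (offset F x).1, fun x => (offset F x).2) :
      (Ioi (0 : ℝ) → ℂ) × (Ioi (0 : ℝ) → ℂ)) ∈ solutionSpace D.φ D.lam := by
  have hs : ContDiffOn ℝ ∞ (fun t : ℝ => (rawMap F (0, t)).1) (Ioi 0) :=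
    ((contDiffOn_rawMap hF.exists_leafwiseHolomorphicOn).comp
      (contDiff_const.prodMk contDiff_id).contDiffOn fun t ht => mk_mem_coverSet ht).fst
  have he : ∀ (t : ℝ) (ht : 0 < t), (rawMap F (0, t)).1 = offset F ⟨t, ht⟩ := fun t ht =>
    congrArg Prod.fst (rawMap_coe F (mkPos 0 ⟨t, ht⟩))
  refine ⟨?_, ?_, fun x => ?_, fun x => ?_⟩
  · refine hs.fst.congr fun t ht => ?_
    rw [extendZero_of_pos _ ht, he t ht]
  · refine hs.snd.congr fun t ht => ?_
    rw [extendZero_of_pos _ ht, he t ht]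
  · simp only [offset_onPos htau hlam hF, jordan]
  · simp only [offset_onPos htau hlam hF, jordan]

include htau hlam in
theorem exists_coverMap_eq {G : Cover → Cover} (hF : IsAutLift (D := D) F)
    (hG : IsAutLift (D := D) G) (hFG : F ∘ G = id) (hGF : G ∘ F = id) :
    ∃ s : D.Semidirect, ∀ q, coverMap s q = F q := by
  set η := toCentralizer hF hG hFG hGF with hη
  let γ : solutionSpace D.φ D.lam := ⟨_, hF.offset_mem_solutionSpace htau hlam⟩
  -- The offset is read at the source height `x`, while `coverMap` evaluates its translation at the
  -- target height `η x`; precomposition with `η⁻¹` makes up for this.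
  refine ⟨⟨Multiplicative.ofAdd (precomp η⁻¹ γ), η⟩, fun q => ?_⟩
  set s : D.Semidirect := ⟨Multiplicative.ofAdd (precomp η⁻¹ γ), η⟩ with hs
  rcases eq_or_lt_of_le q.2.1 with h | h
  · have hq : height q = 0 := NNReal.eq h.symm
    rw [coverMap_of_height_eq_zero s hq, hF.eq_self q hq]
  · have ht : translation s q.1.2 = offset F ⟨q.1.2, h⟩ := by
      have hc : onPos (η⁻¹).1 (onPos η.1 ⟨q.1.2, h⟩) = ⟨q.1.2, h⟩ := by
        rw [← onPos_mul, ← Subgroup.coe_mul, inv_mul_cancel]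
        rfl
      rw [translation_of_pos s h]
      change ((offset F (onPos (η⁻¹).1 (onPos η.1 ⟨q.1.2, h⟩))).1,
        (offset F (onPos (η⁻¹).1 (onPos η.1 ⟨q.1.2, h⟩))).2) = _
      rw [hc]
    refine Subtype.ext (Prod.ext ?_ ?_)
    · change q.1.1 + translation s q.1.2 = (F q).1.1
      rw [ht]
      exact (hF.apply_mkPos htau hlam q.1.1 ⟨q.1.2, h⟩).symm
    · have h1 := height_coverMap s q
      have h2 := hF.height_apply q
      exact congrArg NNReal.toReal (h1.trans h2.symm)

end IsAutLift

include htau hlam in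
theorem exists_isAutLift (f : D.autRH) :
    ∃ F : Cover → Cover, IsLift (f.1.1 : D.Reeb → D.Reeb) F ∧ IsAutLift (D := D) F := by
  have hfix : ∀ r ∈ D.boundary, f.1.1 r = r := (mem_fixingSubgroup_iff _).mp f.2
  obtain ⟨F, hF⟩ := exists_isLift htau hlam f.1.2.1.continuous (hfix _ ⟨basePoint, rfl, rfl⟩)
  exact ⟨F, hF, hF.exists_leafwiseHolomorphicOn htau hlam f.1.2.1,
    fun q hq => hF.eq_self_of_height_eq_zero htau hlam hfix hq,
    hF.apply_T htau hlam hfix⟩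

/-- The lifts of `f` and `f⁻¹` that fix the base point are mutually inverse by uniqueness of lifts,
which is what makes the transverse map a diffeomorphism. -/
theorem toAutRH_surjective (hφ : InfinitelyTangentToId D.φ) :
    Function.Surjective (toAutRH htau hlam hφ) := by
  intro f
  obtain ⟨F, hF, hF'⟩ := exists_isAutLift htau hlam f
  obtain ⟨G, hG, hG'⟩ := exists_isAutLift htau hlam f⁻¹
  have hFG : F ∘ G = id := by
    refine IsLift.unique htau hlam (hF.comp hG) ?_
    convert IsLift.id (D := D) using 1
    exact funext f.1.1.apply_symm_apply
  have hGF : G ∘ F = id := by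
    refine IsLift.unique htau hlam (hG.comp hF) ?_
    convert IsLift.id (D := D) using 1
    exact funext f.1.1.symm_apply_apply
  obtain ⟨s, hs⟩ := hF'.exists_coverMap_eq htau hlam hG' hFG hGF
  refine ⟨s, Subtype.ext (Subtype.ext (Equiv.ext fun r => ?_))⟩
  obtain ⟨q, rfl⟩ := proj_surjective r
  rw [toAutRH_apply_proj, hs, hF.proj_apply]

/-- The isomorphism of the semidirect product with `Aut(R, H)`. -/
noncomputable def semidirectEquiv (hφ : InfinitelyTangentToId D.φ) : D.Semidirect ≃* D.autRH :=
  MulEquiv.ofBijective (toAutRH htau hlam hφ)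
    ⟨toAutRH_injective htau hlam hφ, toAutRH_surjective htau hlam hφ⟩

theorem semidirectEquiv_apply_proj (hφ : InfinitelyTangentToId D.φ) (s : D.Semidirect)
    (z : ℂ × ℂ) (x : Ioi (0 : ℝ)) :
    (semidirectEquiv htau hlam hφ s).1.1 (D.proj (mkPos z x)) =
      D.proj (mkPos (z.1 + s.left.toAdd.1.1 (onPos s.right.1 x),
        z.2 + s.left.toAdd.1.2 (onPos s.right.1 x)) (onPos s.right.1 x)) := by
  refine congrArg D.proj (Subtype.ext (Prod.ext ?_ ?_))
  · change z + translation s x.1 = _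
    rw [translation_of_pos s x.2]
    rfl
  · exact (coe_onPos s.right.1 x).symm

end HopfData

end LCReeb

/-! ### The exact sequence and its splitting -/

theorem theorem3p12 (D : LCReeb.HopfData) (hφ : LCReeb.InfinitelyTangentToId D.φ)
    (htau : D.tau = 1) (hlam : D.lam = D.mu) :
    ¬ FiniteDimensional ℂ (LCReeb.solutionSpace D.φ D.lam) ∧
    (∀ β ∈ LCReeb.solutionSpace D.φ D.lam,
      ContDiffOn ℝ ∞ (LCReeb.extendZero β.1) (Set.Ici 0) ∧
      ContDiffOn ℝ ∞ (LCReeb.extendZero β.2) (Set.Ici 0)) ∧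
    ∃ (i : Multiplicative (LCReeb.solutionSpace D.φ D.lam) →* D.autRH)
      (P : D.autRH →* LCReeb.centralizerOf D.φ)
      (e : Multiplicative (LCReeb.solutionSpace D.φ D.lam) ⋊[LCReeb.precompAction D.φ D.lam]
        LCReeb.centralizerOf D.φ ≃* D.autRH),
      Function.Injective i ∧ i.range = P.ker ∧ Function.Surjective P ∧
      (∀ β, e (SemidirectProduct.inl β) = i β) ∧
      (∀ s, P (e s) = s.right) ∧
      (∀ (β : LCReeb.solutionSpace D.φ D.lam) (z : ℂ × ℂ) (x : Set.Ioi (0 : ℝ)),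
        (i (Multiplicative.ofAdd β)).1.1 (D.proj (LCReeb.mkPos z x)) =
          D.proj (LCReeb.mkPos (z.1 + β.1.1 x, z.2 + β.1.2 x) x)) ∧
      (∀ (η : LCReeb.centralizerOf D.φ) (z : ℂ × ℂ) (x : Set.Ioi (0 : ℝ)),
        (e (SemidirectProduct.inr η)).1.1 (D.proj (LCReeb.mkPos z x)) =
          D.proj (LCReeb.mkPos z (LCReeb.onPos η.1 x))) := by
  refine ⟨LCReeb.not_finiteDimensional_solutionSpace D.expanding D.lam_ne_zero,
    fun β hβ => LCReeb.contDiffOn_extendZero_of_mem_solutionSpace D.expanding hφ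
      LCReeb.HopfData.one_lt_norm_lam hβ, ?_⟩
  let e := LCReeb.HopfData.semidirectEquiv htau hlam hφ
  -- The maps `i` and `P` are the canonical inclusion and projection of the semidirect product
  -- carried over by `e`, so exactness is that of the split extension.
  refine ⟨e.toMonoidHom.comp SemidirectProduct.inl,
    SemidirectProduct.rightHom.comp e.symm.toMonoidHom, e,
    e.injective.comp SemidirectProduct.inl_injective, ?_,
    SemidirectProduct.rightHom_surjective.comp e.symm.surjective, fun _ => rfl, fun s => ?_,
    fun β z x => ?_, fun η z x => ?_⟩
  · ext f
    rw [MonoidHom.mem_range, MonoidHom.mem_ker]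
    change (∃ β, e (SemidirectProduct.inl β) = f) ↔ (e.symm f) ∈ SemidirectProduct.rightHom.ker
    rw [← SemidirectProduct.range_inl_eq_ker_rightHom, MonoidHom.mem_range]
    simp only [MulEquiv.eq_symm_apply]
  · change (e.symm (e s)).right = s.right
    rw [MulEquiv.symm_apply_apply]
  · exact LCReeb.HopfData.semidirectEquiv_apply_proj htau hlam hφ _ z x
  · refine (LCReeb.HopfData.semidirectEquiv_apply_proj htau hlam hφ _ z x).trans ?_
    change D.proj (LCReeb.mkPos (z.1 + 0, z.2 + 0) (LCReeb.onPos η.1 x)) = _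
    rw [add_zero, add_zero]
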